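/- Let $H$ be a complex Hilbert space of finite dimension $n$ and let $u^*(H)$ be the real vector space of Hermitian operators on $H$ (with the operator norm $\|\cdot\|$), equipped with the scalar product $\langle A,B\rangle=\frac12\operatorname{Tr}(AB)$, the Lie bracket $[A,B]=\frac1i(AB-BA)$ and the Jordan product $[A,B]_+=AB+BA$. For $A\in u^*(H)$ let $\widehat A=\langle A,\cdot\rangle$ be the corresponding covector. Let $R(\xi)(\widehat A,\widehat B)=\langle\xi,[A,B]_+\rangle$ and $\Lambda(\xi)(\widehat A,\widehat B)=\langle\xi,[A,B]\rangle$ be the Riemann–Jordan tensor and the Kostant–Kirillov–Souriau (KKS) Poisson tensor on $u^*(H)$. For a contravariant 2-tensor $T$ at $\xi$ let $\#T(\widehat A)$ be the vector with $\langle \#T(\widehat A),B\rangle=T(\widehat A,\widehat B)$ for all $B$; its (partial) inverse is the covariant tensor $(v,w)\mapsto\langle A,w\rangle$, where $v=\#T(\widehat A)$, defined for $v,w$ in the image of $\#T$. Let $\sigma=R^{-1}$ be the partial tensor so obtained from $R$, and let $\eta_\xi$ be the inverse of $\Lambda(\xi)$, i.e. the KKS form on the tangent space $\{[A,\xi]: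 A\in u^*(H)\}$ of the unitary orbit $\{U\xi U^\dagger\}$ through $\xi$. Thus $\sigma_\xi([A,\xi]_+,[B,\xi]_+)=\langle[A,\xi]_+,B\rangle$ and $\eta_\xi([A,\xi],[B,\xi])=\langle[A,\xi],B\rangle$. Let $\mu(x)=|x\rangle\langle x|$, let $P^1(H)=\{\mu(x):x\neq0\}$ be the cone of non-negative rank-one operators and, for $r>0$, let $D^1_r(H)=\{\mu(x):\|x\|=r\}$; it consists of operators of norm $r^2$ and it is the unitary orbit of each of its elements. Put $\mathcal J_\xi(A)=\frac1{\|\xi\|}[A,\xi]$ for $\xi\in P^1(H)$. (a) For all $r>0$, $\xi\in D^1_r(H)$ and $A,B\in u^*(H)$, the vectors $[A,\xi]$ and $[B,\xi]$ lie in the domain of $\sigma_\xi$ and $$\sigma_\xi([A,\xi],[B,\xi])=\frac1{\|\xi\|}\langle[A,\xi],[B,\xi]\rangle .$$ (b) $\mathcal J$ is a smooth $(1,1)$-tensor on $P^1(H)$ (it maps the tangent space $\operatorname{im} d\mu_x$ of $P^1(H)$ at $\mu(x)$ into itself), and $\mathcal J_\xi^3=-\mathcal J_\xi$ on $u^*(H)$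 for every $\xi\in P^1(H)$. For every $r>0$ it maps the tangent spaces of $D^1_r(H)$ into themselves, with $\mathcal J^2=-1$ there, and for all $\xi\in D^1_r(H)$ and $A,B\in u^*(H)$, $$\eta_\xi([A,\xi],\mathcal J_\xi([B,\xi]))=\sigma_\xi([A,\xi],[B,\xi]),\qquad \eta_\xi(\mathcal J_\xi([A,\xi]),\mathcal J_\xi([B,\xi]))=\eta_\xi([A,\xi],[B,\xi]).$$ Moreover $D^1_r(H)$ is a smooth embedded submanifold of $u^*(H)$ of real dimension $2(n-1)$ (if $n\ge1$), with tangent space $\{[A,\xi]:A\in u^*(H)\}$ at $\xi$, and with the restrictions of $\mathcal J$, $\sigma$ and $\eta$ it is a Kähler manifold: $\mathcal J$ is an integrable complex structure (around every point there are smooth coordinates with values in $\mathbb C^{n-1}$ in which $\mathcal J$ is multiplication by $i$), $\sigma$ is a Riemannian metric, and $\eta$ is a symplectic form (smooth, closed, non-degenerate), compatible in the sense of the two identities above. -/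

import Mathlib

open scoped Manifold ContDiff InnerProductSpace

noncomputable section

namespace QGeom

/-! ### Hermitian operators, brackets and the trace scalar product -/

section Operators

variable (H : Type*) [NormedAddCommGroup H] [InnerProductSpace ℂ H] [CompleteSpace H]

/-- The real vector space `u*(H)` of Hermitian operators on `H`, with the operator norm. -/
abbrev Herm : Type _ := selfAdjoint (H →L[ℂ] H)

variable {H}

/-- The Lie bracket `[A, B] = (1/i) (AB - BA)` of Hermitian operators. -/
def lie (A B : Herm H) : Herm H :=
  ⟨(1 / Complex.I) • ((A : H →L[ℂ] H) * B - B * A), by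
    have hA : star (A : H →L[ℂ] H) = A := A.2
    have hB : star (B : H →L[ℂ] H) = B := B.2
    change star _ = _
    simp [star_smul, star_mul, hA, hB, smul_sub]
    abel⟩

/-- The Jordan product `[A, B]₊ = AB + BA` of Hermitian operators. -/
def jordan (A B : Herm H) : Herm H :=
  ⟨(A : H →L[ℂ] H) * B + B * A, by
    have hA : star (A : H →L[ℂ] H) = A := A.2
    have hB : star (B : H →L[ℂ] H) = B := B.2
    change star _ = _
    simp [star_add, star_mul, hA, hB, add_comm]⟩

/-- The scalar product `⟨A, B⟩ = (1/2) Tr(AB)` of Hermitian operators (the trace is real). -/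
def trInner (A B : Herm H) : ℝ :=
  (1 / 2) * (LinearMap.trace ℂ H (((A : H →L[ℂ] H) * B : H →L[ℂ] H) : H →ₗ[ℂ] H)).re

/-! ### The Riemann–Jordan tensor, the Kostant–Kirillov–Souriau tensor and their inverses -/

/-- The Riemann–Jordan tensor `R(ξ)(Â, B̂) = ⟨ξ, [A, B]₊⟩`, where `Â` is the
covector `⟨A, ·⟩`. -/
def riemannJordan (ξ A B : Herm H) : ℝ := trInner ξ (jordan A B)

/-- The Kostant–Kirillov–Souriau Poisson tensor `Λ(ξ)(Â, B̂) = ⟨ξ, [A, B]⟩`. -/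
def kksPoisson (ξ A B : Herm H) : ℝ := trInner ξ (lie A B)

/-- `IsSharp T A v` says that `v` is the vector `#T(Â) = T(Â, ·)` that the contravariant
2-tensor `T` assigns to the covector `Â = ⟨A, ·⟩`. -/
def IsSharp (T : Herm H → Herm H → ℝ) (A v : Herm H) : Prop :=
  ∀ B, trInner v B = T A B

open Classical in
/-- The inverse of a contravariant 2-tensor `T`, as a covariant 2-tensor that is only
meaningful on vectors of the image of `#T`: its value on `(v, w)` is `⟨(#T)⁻¹ v, w⟩`.
(When `v` is not in the image of `#T`, the value is set to `0`.) -/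
def inverseTensor (T : Herm H → Herm H → ℝ) (v w : Herm H) : ℝ :=
  if h : ∃ A, IsSharp T A v then trInner h.choose w else 0

/-- The partial tensor `σ = R⁻¹`, at `ξ`. -/
def sigma (ξ : Herm H) (v w : Herm H) : ℝ := inverseTensor (riemannJordan ξ) v w

/-- The Kostant–Kirillov–Souriau form at `ξ` of the unitary orbit through `ξ`: the inverse of
the Poisson tensor `Λ` on the tangent space of the orbit. -/
def kksForm (ξ : Herm H) (v w : Herm H) : ℝ := inverseTensor (kksPoisson ξ) v w

/-- The tensor `𝒥_ξ(A) = [A, ξ] / ‖ξ‖`, where `‖ξ‖` is the operator norm. -/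
def calJ (ξ A : Herm H) : Herm H := (1 / ‖ξ‖) • lie A ξ

/-! ### The momentum map, the cone of rank-one positive operators and the orbits -/

/-- The momentum map `μ(x) = |x⟩⟨x|`, that is `μ(x) z = ⟨x, z⟩ x`. -/
def momentum (x : H) : Herm H :=
  ⟨InnerProductSpace.rankOne ℂ x x, by
    change star _ = _
    rw [ContinuousLinearMap.star_eq_adjoint, InnerProductSpace.adjoint_rankOne]⟩

variable (H) in
/-- The cone `P¹(H)` of non-negative Hermitian operators of rank one. -/
def rankOneCone : Set (Herm H) := momentum '' {x : H | x ≠ 0}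

variable (H) in
/-- `D¹_r(H) = { |x⟩⟨x| : ‖x‖ = r }`. -/
def rankOneOrbit (r : ℝ) : Set (Herm H) := momentum '' {x : H | ‖x‖ = r}

/-- The orbit of `ξ` under the action `ξ ↦ U ξ U†` of the unitary group. -/
def unitaryOrbit (ξ : Herm H) : Set (Herm H) :=
  {ζ | ∃ U ∈ unitary (H →L[ℂ] H), (ζ : H →L[ℂ] H) = U * ξ * star U}

/-- The tangent space at `ξ` of the unitary orbit through `ξ`: all `[A, ξ]`, `A` Hermitian. -/
def orbitTangent (ξ : Herm H) : Set (Herm H) := Set.range fun A => lie A ξ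

/-! ### The characterizations of `η` and `σ` -/

section Characterization

theorem trInner_comm (A B : Herm H) : trInner A B = trInner B A := by
  unfold trInner
  congr 2
  exact LinearMap.trace_mul_comm ℂ (A : H →L[ℂ] H).toLinearMap (B : H →L[ℂ] H).toLinearMap

/-- Invariance of the scalar product under the Lie bracket. -/
theorem trInner_lie (A B C : Herm H) : trInner (lie A B) C = trInner A (lie B C) := by
  have h := LinearMap.trace_mul_comm ℂ (B : H →L[ℂ] H).toLinearMap
    ((A : H →L[ℂ] H) * (C : H →L[ℂ] H)).toLinearMap
  have e1 : (((lie A B : Herm H) : H →L[ℂ] H) * C : H →L[ℂ] H).toLinearMap =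
      (1 / Complex.I) • ((A : H →L[ℂ] H).toLinearMap * (B : H →L[ℂ] H).toLinearMap *
        (C : H →L[ℂ] H).toLinearMap - (B : H →L[ℂ] H).toLinearMap *
        ((A : H →L[ℂ] H) * (C : H →L[ℂ] H)).toLinearMap) := by
    ext z; simp [lie]
  have e2 : ((A : H →L[ℂ] H) * (lie B C : Herm H) : H →L[ℂ] H).toLinearMap =
      (1 / Complex.I) • ((A : H →L[ℂ] H).toLinearMap * (B : H →L[ℂ] H).toLinearMap *
        (C : H →L[ℂ] H).toLinearMap - ((A : H →L[ℂ] H) * (C : H →L[ℂ] H)).toLinearMap *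
        (B : H →L[ℂ] H).toLinearMap) := by
    ext z; simp [lie]
  unfold trInner
  rw [e1, e2, map_smul, map_smul, map_sub, map_sub, h]

/-- Invariance of the scalar product under the Jordan product. -/
theorem trInner_jordan (A B C : Herm H) :
    trInner (jordan A B) C = trInner A (jordan B C) := by
  have h := LinearMap.trace_mul_comm ℂ (B : H →L[ℂ] H).toLinearMap
    ((A : H →L[ℂ] H) * (C : H →L[ℂ] H)).toLinearMap
  have e1 : (((jordan A B : Herm H) : H →L[ℂ] H) * C : H →L[ℂ] H).toLinearMap =
      (A : H →L[ℂ] H).toLinearMap * (B : H →L[ℂ] H).toLinearMap *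
        (C : H →L[ℂ] H).toLinearMap + (B : H →L[ℂ] H).toLinearMap *
        ((A : H →L[ℂ] H) * (C : H →L[ℂ] H)).toLinearMap := by
    ext z; simp [jordan]
  have e2 : ((A : H →L[ℂ] H) * (jordan B C : Herm H) : H →L[ℂ] H).toLinearMap =
      (A : H →L[ℂ] H).toLinearMap * (B : H →L[ℂ] H).toLinearMap *
        (C : H →L[ℂ] H).toLinearMap + ((A : H →L[ℂ] H) * (C : H →L[ℂ] H)).toLinearMap *
        (B : H →L[ℂ] H).toLinearMap := by
    ext z; simp [jordan]
  unfold trInner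
  rw [e1, e2, map_add, map_add, h]

theorem lie_neg_left (A B : Herm H) : lie (-A) B = lie B A := by
  apply Subtype.ext
  simp only [lie, AddSubgroup.coe_neg, neg_mul, mul_neg]
  congr 1
  abel

theorem jordan_comm (A B : Herm H) : jordan A B = jordan B A := by
  apply Subtype.ext
  simp only [jordan]
  abel

/-- `η_ξ([A, ξ], [B, ξ]) = ⟨[A, ξ], B⟩`. -/
theorem kksForm_lie (ξ A B : Herm H) :
    kksForm ξ (lie A ξ) (lie B ξ) = trInner (lie A ξ) B := by
  have h : ∃ A', IsSharp (kksPoisson ξ) A' (lie A ξ) := by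
    refine ⟨-A, fun C => ?_⟩
    rw [kksPoisson, ← trInner_lie ξ, ← lie_neg_left (-A) ξ, neg_neg]
  unfold kksForm inverseTensor
  rw [dif_pos h, ← trInner_lie, trInner_comm]
  exact (h.choose_spec B).symm

/-- `σ_ξ([A, ξ]₊, [B, ξ]₊) = ⟨[A, ξ]₊, B⟩`. -/
theorem sigma_jordan (ξ A B : Herm H) :
    sigma ξ (jordan A ξ) (jordan B ξ) = trInner (jordan A ξ) B := by
  have h : ∃ A', IsSharp (riemannJordan ξ) A' (jordan A ξ) := by
    refine ⟨A, fun C => ?_⟩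
    rw [riemannJordan, ← trInner_jordan ξ, jordan_comm ξ A]
  unfold sigma inverseTensor
  rw [dif_pos h, ← trInner_jordan, trInner_comm]
  exact (h.choose_spec B).symm

end Characterization

end Operators

/-! ### Submanifolds and Kähler manifolds -/

section Geometry

/-- The tangent space at `p` of a manifold with charts in the complex vector space `F`, regarded
as a real manifold. -/
abbrev RTangent (F : Type*) [NormedAddCommGroup F] [NormedSpace ℂ F]
    {M : Type*} [TopologicalSpace M] [ChartedSpace F M] (p : M) : Type _ :=
  TangentSpace 𝓘(ℝ, F) p

/-- The derivative at `p` of the inclusion into `E` of a subset `S` that carries charts. -/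
def inclDeriv (F : Type*) [NormedAddCommGroup F] [NormedSpace ℂ F]
    {E : Type*} [NormedAddCommGroup E] [NormedSpace ℝ E] {S : Set E} [ChartedSpace F S]
    (p : S) : RTangent F p →L[ℝ] E :=
  mfderiv 𝓘(ℝ, F) 𝓘(ℝ, E) (Subtype.val : S → E) p

/-- The charts of `S` (in a finite-dimensional space `F`, for the subspace topology of `S`)
make `S` a smooth embedded submanifold of `E` whose tangent space at `p`, as a subset of `E`,
is `T p`. -/
structure IsEmbeddedSubmanifold (F : Type*) [NormedAddCommGroup F] [NormedSpace ℂ F]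
    [FiniteDimensional ℂ F]
    {E : Type*} [NormedAddCommGroup E] [NormedSpace ℝ E] (S : Set E) [ChartedSpace F S]
    (T : E → Set E) : Prop where
  isManifold : IsManifold 𝓘(ℝ, F) ∞ S
  contMDiff_incl : ContMDiff 𝓘(ℝ, F) 𝓘(ℝ, E) ∞ (Subtype.val : S → E)
  injective_inclDeriv : ∀ p : S, Function.Injective (inclDeriv F p)
  range_inclDeriv : ∀ p : S, Set.range (inclDeriv F p) = T p

section Tensors

variable {F : Type*} [NormedAddCommGroup F] [NormedSpace ℂ F]
  {M : Type*} [TopologicalSpace M] [ChartedSpace F M]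

/-- The coordinate vector field with constant components `u` in the chart `e`, at the point
with coordinates `y`. -/
def coordVec (e : OpenPartialHomeomorph M F) (y u : F) : RTangent F (e.symm y) :=
  mfderiv 𝓘(ℝ, F) 𝓘(ℝ, F) e.symm y u

/-- The derivative of the chart `e` at `q`: it sends a tangent vector to its coordinates. -/
def chartDeriv (e : OpenPartialHomeomorph M F) (q : M) : RTangent F q →L[ℝ] F :=
  mfderiv 𝓘(ℝ, F) 𝓘(ℝ, F) e q

/-- The component `η(u, v)` of a covariant 2-tensor in the chart `e`, as a function of the
coordinates `y`. -/
def formInChart (η : ∀ p : M, RTangent F p →L[ℝ] RTangent F p →L[ℝ] ℝ)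
    (e : OpenPartialHomeomorph M F) (u v y : F) : ℝ :=
  η (e.symm y) (coordVec e y u) (coordVec e y v)

/-- The coordinates of the vector field `J u` in the chart `e`, as a function of the
coordinates `y`. -/
def endoInChart (J : ∀ p : M, RTangent F p →L[ℝ] RTangent F p)
    (e : OpenPartialHomeomorph M F) (u y : F) : F :=
  chartDeriv e (e.symm y) (J (e.symm y) (coordVec e y u))

/-- Smoothness of a covariant 2-tensor: its components in all charts are smooth. -/
def IsSmoothForm (η : ∀ p : M, RTangent F p →L[ℝ] RTangent F p →L[ℝ] ℝ) : Prop :=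
  ∀ e ∈ atlas F M, ∀ u v : F, ContDiffOn ℝ ∞ (formInChart η e u v) e.target

/-- Smoothness of a (1,1)-tensor: its components in all charts are smooth. -/
def IsSmoothEndo (J : ∀ p : M, RTangent F p →L[ℝ] RTangent F p) : Prop :=
  ∀ e ∈ atlas F M, ∀ u : F, ContDiffOn ℝ ∞ (endoInChart J e u) e.target

/-- `dη = 0`, in all charts: `∂ᵤ η(v, w) - ∂ᵥ η(u, w) + ∂_w η(u, v) = 0` for constant
`u`, `v`, `w`. -/
def IsClosedForm (η : ∀ p : M, RTangent F p →L[ℝ] RTangent F p →L[ℝ] ℝ) : Prop :=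
  ∀ e ∈ atlas F M, ∀ y ∈ e.target, ∀ u v w : F,
    fderiv ℝ (formInChart η e v w) y u - fderiv ℝ (formInChart η e u w) y v
      + fderiv ℝ (formInChart η e u v) y w = 0

/-- A Riemannian metric: a smooth field of positive definite symmetric bilinear forms. -/
structure IsRiemannianMetric
    (g : ∀ p : M, RTangent F p →L[ℝ] RTangent F p →L[ℝ] ℝ) : Prop where
  smooth : IsSmoothForm g
  symm : ∀ p v w, g p v w = g p w v
  pos : ∀ p v, v ≠ 0 → 0 < g p v v

/-- A symplectic form: a smooth closed non-degenerate 2-form. -/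
structure IsSymplecticForm
    (η : ∀ p : M, RTangent F p →L[ℝ] RTangent F p →L[ℝ] ℝ) : Prop where
  smooth : IsSmoothForm η
  alternating : ∀ p v, η p v v = 0
  nondegenerate : ∀ p v, (∀ w, η p v w = 0) → v = 0
  closed : IsClosedForm η

/-- An integrable (almost) complex structure: a smooth field of endomorphisms `J` of the tangent
spaces with `J² = -1`, such that around every point there is a chart with values in the complex
vector space `F`, smoothly compatible with the given ones, whose derivative turns `J` into
multiplication by `i`. -/
structure IsComplexStructure (J : ∀ p : M, RTangent F p →L[ℝ] RTangent F p) : Prop where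
  smooth : IsSmoothEndo J
  sq : ∀ p v, J p (J p v) = -v
  integrable : ∀ p : M, ∃ e ∈ IsManifold.maximalAtlas 𝓘(ℝ, F) ∞ M, p ∈ e.source ∧
    ∀ q ∈ e.source, ∀ v : RTangent F q,
      chartDeriv e q (J q v) = Complex.I • chartDeriv e q v

end Tensors

/-- `(M, J, g, η)` is a Kähler manifold, where `M` has charts in the finite-dimensional complex
vector space `F`, regarded as a real vector space: `M` is a Hausdorff second countable smooth
manifold, `J` an integrable complex structure, `g` a Riemannian metric, `η` a symplectic form,
with `η(v, J w) = g(v, w)` and `η(J v, J w) = η(v, w)`. -/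
structure IsKahlerManifold (F : Type*) [NormedAddCommGroup F] [NormedSpace ℂ F]
    [FiniteDimensional ℂ F] (M : Type*) [TopologicalSpace M] [ChartedSpace F M]
    (J : ∀ p : M, RTangent F p →L[ℝ] RTangent F p)
    (g η : ∀ p : M, RTangent F p →L[ℝ] RTangent F p →L[ℝ] ℝ) : Prop where
  t2 : T2Space M
  secondCountable : SecondCountableTopology M
  isManifold : IsManifold 𝓘(ℝ, F) ∞ M
  complexStructure : IsComplexStructure J
  metric : IsRiemannianMetric g
  symplectic : IsSymplecticForm η
  compatible : ∀ p v w, η p v (J p w) = g p v w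
  invariant : ∀ p v w, η p (J p v) (J p w) = η p v w

end Geometry

end QGeom

end

/-!
A point of `D¹_r(H)` is `ξ = |x⟩⟨x|` with `‖x‖ = r`, a positive multiple of a projection:
`ξ² = ‖ξ‖ ξ`. All the pointwise identities follow from this relation alone
(`IsScaledProjection`). The tangent vectors `[A, ξ]` are exactly the `v` with
`v ξ + ξ v = ‖ξ‖ v`, the block off-diagonal operators. On them `𝒥² = -1`, the Jordan product with
`ξ` is multiplication by `‖ξ‖`, which gives `σ(v, w) = ⟨v, w⟩ / ‖ξ‖`, and
`η(v, w) = -⟨ξ, [v, w]⟩ / ‖ξ‖²`.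

For the manifold structure, let `u` be a unit vector and `L : F → u^⊥` an antilinear
isomorphism. The affine chart at `u` has the inverse `ψ(y) = r² |x⟩⟨x| / ‖x‖²` with
`x = u + L y`, defined on the whole of `F`, and is itself the restriction of a map that is smooth
on an open set of Hermitian operators. This makes the transition maps smooth and the orbit an
embedded submanifold (`IsAmbientChart`). Since `𝒥` turns `|x⟩⟨z| + |z⟩⟨x|` into
`|x⟩⟨-iz| + |-iz⟩⟨x|` up to a multiple of `ξ`, the antilinearity of `L` makes `𝒥` multiplication
by `i` in these charts (`AntilinearFrame.calJ_fderiv_affineParam`); the multiples of `ξ` never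
matter, because `𝒥` kills them and is injective on the tangent space.

The form `η` is the restriction of the two-form `-r⁻⁴ ⟨ξ, [v, w]⟩` on the space of Hermitian
operators, whose coefficients are linear in `ξ`. The exterior derivative of its pullback by `ψ` is
a combination of the numbers `⟨u, [v, w]⟩` with `u`, `v`, `w` tangent
(`exteriorDeriv_pullback`). These vanish: the bracket of two off-diagonal operators is block
diagonal, hence orthogonal to the off-diagonal ones
(`IsScaledProjection.trInner_lie_eq_zero`).
-/

namespace QGeom

/-! ### The brackets and the scalar product as bilinear maps -/

section Algebra

variable {H : Type*} [NormedAddCommGroup H] [InnerProductSpace ℂ H] [CompleteSpace H]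

-- The following instances shorten the search through the self-adjoint subgroup. They are scoped:
-- elsewhere the real vector space structure is found by the general search.
noncomputable scoped instance : NormedSpace ℝ (Herm H) := inferInstance

noncomputable scoped instance : Module ℝ (Herm H) := NormedSpace.toModule

noncomputable scoped instance : DistribMulAction ℝ (Herm H) := Module.toDistribMulAction

noncomputable scoped instance : MulAction ℝ (Herm H) := DistribMulAction.toMulAction

noncomputable scoped instance : SMulZeroClass ℝ (Herm H) := DistribSMul.toSMulZeroClass

scoped instance : SMulCommClass ℝ ℝ (Herm H) := inferInstance

theorem coe_smul_herm (c : ℝ) (A : Herm H) :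
    ((c • A : Herm H) : H →L[ℂ] H) = c • (A : H →L[ℂ] H) := rfl

theorem coe_lie (A B : Herm H) :
    (lie A B : H →L[ℂ] H) = (-Complex.I) • ((A : H →L[ℂ] H) * B - B * A) := by
  simp [lie]

theorem coe_jordan (A B : Herm H) :
    (jordan A B : H →L[ℂ] H) = (A : H →L[ℂ] H) * B + B * A := rfl

variable (H) in
/-- The Lie bracket of Hermitian operators as a real bilinear map. -/
noncomputable def lieBilin : Herm H →ₗ[ℝ] Herm H →ₗ[ℝ] Herm H :=
  LinearMap.mk₂ ℝ lie
    (fun A A' B => by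
      apply Subtype.ext
      simp only [coe_lie, AddSubgroup.coe_add, add_mul, mul_add, ← smul_add]
      congr 1; abel)
    (fun c A B => by
      apply Subtype.ext
      simp only [coe_lie, coe_smul_herm, smul_mul_assoc, mul_smul_comm, ← smul_sub]
      rw [smul_comm])
    (fun A B B' => by
      apply Subtype.ext
      simp only [coe_lie, AddSubgroup.coe_add, add_mul, mul_add, ← smul_add]
      congr 1; abel)
    (fun c A B => by
      apply Subtype.ext
      simp only [coe_lie, coe_smul_herm, smul_mul_assoc, mul_smul_comm, ← smul_sub]
      rw [smul_comm])

variable (H) in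
/-- The trace scalar product as a real bilinear form. -/
noncomputable def trBilin : Herm H →ₗ[ℝ] Herm H →ₗ[ℝ] ℝ :=
  LinearMap.mk₂ ℝ trInner
    (fun A A' B => by
      simp only [trInner, AddSubgroup.coe_add, add_mul, ContinuousLinearMap.toLinearMap_add,
        map_add, Complex.add_re, mul_add])
    (fun c A B => by
      simp only [trInner, coe_smul_herm, smul_mul_assoc, ← Complex.coe_smul,
        ContinuousLinearMap.toLinearMap_smul, map_smul, smul_eq_mul, Complex.re_ofReal_mul]
      ring)
    (fun A B B' => by
      simp only [trInner, AddSubgroup.coe_add, ContinuousLinearMap.toLinearMap_add, map_add,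
        Complex.add_re, mul_add])
    (fun c A B => by
      simp only [trInner, coe_smul_herm, mul_smul_comm, ← Complex.coe_smul,
        ContinuousLinearMap.toLinearMap_smul, map_smul, smul_eq_mul, Complex.re_ofReal_mul]
      ring)

theorem lie_smul_left (c : ℝ) (A B : Herm H) : lie (c • A) B = c • lie A B :=
  (lieBilin H).map_smul₂ c A B

theorem lie_smul_right (c : ℝ) (A B : Herm H) : lie A (c • B) = c • lie A B :=
  (lieBilin H A).map_smul c B

theorem lie_add_left (A A' B : Herm H) : lie (A + A') B = lie A B + lie A' B :=
  (lieBilin H).map_add₂ A A' B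

theorem trInner_smul_left (c : ℝ) (A B : Herm H) : trInner (c • A) B = c * trInner A B :=
  (trBilin H).map_smul₂ c A B

theorem trInner_smul_right (c : ℝ) (A B : Herm H) : trInner A (c • B) = c * trInner A B :=
  (trBilin H A).map_smul c B

theorem trInner_neg_right (A B : Herm H) : trInner A (-B) = -trInner A B :=
  (trBilin H A).map_neg B

theorem jordan_smul_left (c : ℝ) (A B : Herm H) : jordan (c • A) B = c • jordan A B := by
  apply Subtype.ext
  simp only [coe_jordan, coe_smul_herm, smul_mul_assoc, mul_smul_comm, ← smul_add]

theorem lie_antisymm (A B : Herm H) : lie A B = -lie B A := by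
  apply Subtype.ext
  simp only [coe_lie, AddSubgroup.coe_neg, ← smul_neg, neg_sub]

theorem lie_self (A : Herm H) : lie A A = 0 := by
  apply Subtype.ext
  simp [coe_lie]

/-- The scalar product is the Hilbert-Schmidt one, hence positive definite. -/
theorem trInner_self_pos [FiniteDimensional ℂ H] {A : Herm H} (hA : A ≠ 0) :
    0 < trInner A A := by
  have key : (LinearMap.trace ℂ H (((A : H →L[ℂ] H) * A : H →L[ℂ] H) : H →ₗ[ℂ] H)).re =
      ∑ i, ‖(A : H →L[ℂ] H) (stdOrthonormalBasis ℂ H i)‖ ^ 2 := by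
    rw [LinearMap.trace_eq_sum_inner _ (stdOrthonormalBasis ℂ H), Complex.re_sum]
    refine Finset.sum_congr rfl fun i _ => ?_
    have h : ContinuousLinearMap.adjoint (A : H →L[ℂ] H) = A := A.2
    change (inner ℂ _ ((A : H →L[ℂ] H) ((A : H →L[ℂ] H) _))).re = _
    rw [← ContinuousLinearMap.adjoint_inner_left, h, inner_self_eq_norm_sq_to_K]
    norm_cast
  unfold trInner
  rw [key]
  have hne : ∃ i, (A : H →L[ℂ] H) (stdOrthonormalBasis ℂ H i) ≠ 0 := by
    by_contra! hcon
    apply hA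
    apply Subtype.ext
    apply ContinuousLinearMap.coe_injective
    exact (stdOrthonormalBasis ℂ H).toBasis.ext fun i => by simpa using hcon i
  obtain ⟨i, hi⟩ := hne
  have : 0 < ∑ i, ‖(A : H →L[ℂ] H) (stdOrthonormalBasis ℂ H i)‖ ^ 2 :=
    Finset.sum_pos' (fun j _ => by positivity) ⟨i, Finset.mem_univ _, by positivity⟩
  linarith

/-! ### Orbits of multiples of projections -/

/-- `ξ` is a positive multiple of an orthogonal projection. -/
structure IsScaledProjection (ξ : Herm H) : Prop where
  ne_zero : ‖ξ‖ ≠ 0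
  mul_self : (ξ : H →L[ℂ] H) * ξ = ‖ξ‖ • (ξ : H →L[ℂ] H)

variable {ξ : Herm H}

theorem lie_mem_orbitTangent (ξ A : Herm H) : lie A ξ ∈ orbitTangent ξ := ⟨A, rfl⟩

theorem smul_mem_orbitTangent (c : ℝ) {v : Herm H} (hv : v ∈ orbitTangent ξ) :
    c • v ∈ orbitTangent ξ := by
  obtain ⟨A, rfl⟩ := hv
  exact ⟨c • A, lie_smul_left c A ξ⟩

theorem calJ_mem_orbitTangent (ξ A : Herm H) : calJ ξ A ∈ orbitTangent ξ :=
  smul_mem_orbitTangent _ (lie_mem_orbitTangent ξ A)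

theorem calJ_add (ξ A B : Herm H) : calJ ξ (A + B) = calJ ξ A + calJ ξ B := by
  simp only [calJ, lie_add_left, smul_add]

theorem calJ_smul (c : ℝ) (ξ A : Herm H) : calJ ξ (c • A) = c • calJ ξ A := by
  rw [calJ, calJ, lie_smul_left, smul_comm]

theorem calJ_self (ξ : Herm H) : calJ ξ ξ = 0 := by
  rw [calJ, lie_self, smul_zero]

/-- `𝒥_ξ` depends only on the ray of `ξ`. -/
theorem calJ_smul_base {c : ℝ} (hc : 0 < c) (ξ A : Herm H) : calJ (c • ξ) A = calJ ξ A := by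
  rw [calJ, calJ, lie_smul_right, smul_smul, norm_smul, Real.norm_of_nonneg hc.le]
  congr 1
  field_simp

theorem kksForm_calJ {v w : Herm H}
    (hv : v ∈ orbitTangent ξ) : kksForm ξ v (calJ ξ w) = ‖ξ‖⁻¹ * trInner v w := by
  obtain ⟨A, rfl⟩ := hv
  simp only
  rw [calJ, ← lie_smul_left, kksForm_lie, trInner_smul_right, one_div]

namespace IsScaledProjection

theorem mul_mul_self (h : IsScaledProjection ξ) (A : H →L[ℂ] H) :
    A * (ξ : H →L[ℂ] H) * ξ = ‖ξ‖ • (A * (ξ : H →L[ℂ] H)) := by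
  rw [mul_assoc, h.mul_self, mul_smul_comm]

theorem self_mul_mul (h : IsScaledProjection ξ) (A : H →L[ℂ] H) :
    (ξ : H →L[ℂ] H) * (ξ * A) = ‖ξ‖ • ((ξ : H →L[ℂ] H) * A) := by
  rw [← mul_assoc, h.mul_self, smul_mul_assoc]

/-- Brackets with `ξ` are block off-diagonal. -/
theorem jordan_lie (h : IsScaledProjection ξ) (A : Herm H) :
    jordan (lie A ξ) ξ = ‖ξ‖ • lie A ξ := by
  apply Subtype.ext
  simp only [coe_jordan, coe_lie, coe_smul_herm, smul_mul_assoc, mul_smul_comm, sub_mul,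
    mul_sub, h.mul_mul_self, h.self_mul_mul, ← smul_add, smul_comm ‖ξ‖ (-Complex.I), mul_assoc]
  congr 1
  simp only [smul_sub]
  abel

/-- A vector that anticommutes with the reflection attached to `ξ` is minus its own second
iterated bracket with `ξ / ‖ξ‖`. -/
theorem lie_lie_of_jordan (h : IsScaledProjection ξ) {v : Herm H}
    (hv : jordan v ξ = ‖ξ‖ • v) : lie (lie v ξ) ξ = (-‖ξ‖ ^ 2) • v := by
  have h0 : (v : H →L[ℂ] H) * ξ + ξ * v = ‖ξ‖ • (v : H →L[ℂ] H) := congrArg Subtype.val hv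
  have h2 : (ξ : H →L[ℂ] H) * (v : H →L[ℂ] H) * ξ = 0 := by
    rw [mul_assoc, eq_sub_of_add_eq h0, mul_sub, h.self_mul_mul, mul_smul_comm, sub_self]
  have h3 : ((v : H →L[ℂ] H) * ξ - ξ * v) * ξ - ξ * ((v : H →L[ℂ] H) * ξ - ξ * v) =
      (‖ξ‖ ^ 2) • (v : H →L[ℂ] H) := by
    rw [sub_mul, mul_sub, h.mul_mul_self, h.self_mul_mul, h2, ← mul_assoc (ξ : H →L[ℂ] H), h2,
      sub_zero, zero_sub, sub_neg_eq_add, ← smul_add, h0, smul_smul, sq]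
  apply Subtype.ext
  rw [coe_lie, coe_lie, smul_mul_assoc, mul_smul_comm, ← smul_sub, h3, smul_smul, coe_smul_herm,
    neg_mul_neg, Complex.I_mul_I, neg_one_smul, neg_smul]

theorem mem_orbitTangent_iff (h : IsScaledProjection ξ) {v : Herm H} :
    v ∈ orbitTangent ξ ↔ jordan v ξ = ‖ξ‖ • v := by
  constructor
  · rintro ⟨A, rfl⟩
    exact h.jordan_lie A
  · intro hv
    refine ⟨(-(‖ξ‖ ^ 2)⁻¹) • lie v ξ, ?_⟩
    have := h.ne_zero
    change lie _ ξ = v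
    rw [lie_smul_left, h.lie_lie_of_jordan hv, smul_smul, neg_mul_neg,
      inv_mul_cancel₀ (pow_ne_zero 2 this), one_smul]

theorem calJ_calJ (h : IsScaledProjection ξ) {v : Herm H} (hv : v ∈ orbitTangent ξ) :
    calJ ξ (calJ ξ v) = -v := by
  have := h.ne_zero
  simp only [calJ, lie_smul_left, h.lie_lie_of_jordan (h.mem_orbitTangent_iff.1 hv), smul_smul]
  rw [← neg_one_smul ℝ v]
  congr 1
  field_simp

/-- `𝒥` is injective on the tangent space. -/
theorem eq_of_calJ_eq (h : IsScaledProjection ξ) {v w : Herm H} (hv : v ∈ orbitTangent ξ)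
    (hw : w ∈ orbitTangent ξ)
    (hvw : calJ ξ v = calJ ξ w) : v = w := by
  rw [← neg_neg v, ← neg_neg w, ← h.calJ_calJ hv, ← h.calJ_calJ hw, hvw]

theorem isSharp_riemannJordan (h : IsScaledProjection ξ) {v : Herm H}
    (hv : v ∈ orbitTangent ξ) : IsSharp (riemannJordan ξ) (‖ξ‖⁻¹ • v) v := by
  intro B
  have hj := h.mem_orbitTangent_iff.1 hv
  rw [riemannJordan, ← trInner_jordan, jordan_comm, jordan_smul_left, hj, smul_smul,
    inv_mul_cancel₀ h.ne_zero, one_smul]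

theorem sigma_eq (h : IsScaledProjection ξ) {v w : Herm H}
    (hv : v ∈ orbitTangent ξ) (hw : w ∈ orbitTangent ξ) :
    sigma ξ v w = ‖ξ‖⁻¹ * trInner v w := by
  have key : ∀ u ∈ orbitTangent ξ, u = jordan (‖ξ‖⁻¹ • u) ξ := fun u hu => by
    rw [jordan_smul_left, h.mem_orbitTangent_iff.1 hu, smul_smul,
      inv_mul_cancel₀ h.ne_zero, one_smul]
  have h1 : sigma ξ v w =
      sigma ξ (jordan (‖ξ‖⁻¹ • v) ξ) (jordan (‖ξ‖⁻¹ • w) ξ) := by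
    rw [← key v hv, ← key w hw]
  rw [h1, sigma_jordan, ← key v hv, trInner_smul_right]

/-- On tangent vectors, the Kostant-Kirillov-Souriau form is a multiple of
`(v, w) ↦ ⟨ξ, [v, w]⟩`. -/
theorem kksForm_eq (h : IsScaledProjection ξ) {v w : Herm H}
    (hv : v ∈ orbitTangent ξ) (hw : w ∈ orbitTangent ξ) :
    kksForm ξ v w = -(‖ξ‖ ^ 2)⁻¹ * trInner ξ (lie v w) := by
  have h1 : w = calJ ξ (-calJ ξ w) := by
    rw [← neg_one_smul ℝ, calJ_smul, h.calJ_calJ hw, smul_neg, neg_one_smul, neg_neg]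
  conv_lhs => rw [h1]
  rw [kksForm_calJ hv, trInner_neg_right, calJ, trInner_smul_right, ← trInner_lie,
    trInner_comm, one_div, sq, mul_inv]
  ring

theorem kksForm_calJ_calJ (h : IsScaledProjection ξ) {v w : Herm H}
    (hv : v ∈ orbitTangent ξ) (hw : w ∈ orbitTangent ξ) :
    kksForm ξ (calJ ξ v) (calJ ξ w) = kksForm ξ v w := by
  rw [kksForm_calJ (calJ_mem_orbitTangent ξ v), h.kksForm_eq hv hw, calJ, trInner_smul_left,
    trInner_comm, ← trInner_lie, trInner_comm, lie_antisymm w v, trInner_neg_right, one_div, sq,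
    mul_inv]
  ring

/-- The bracket of two tangent vectors is block diagonal, so it commutes with `ξ`. -/
theorem lie_self_lie (h : IsScaledProjection ξ) {v w : Herm H}
    (hv : v ∈ orbitTangent ξ) (hw : w ∈ orbitTangent ξ) : lie ξ (lie v w) = 0 := by
  have key : ∀ u ∈ orbitTangent ξ,
      (ξ : H →L[ℂ] H) * (u : H →L[ℂ] H) = ‖ξ‖ • (u : H →L[ℂ] H) - u * ξ := fun u hu =>
    eq_sub_of_add_eq ((add_comm _ _).trans
      (congrArg Subtype.val (h.mem_orbitTangent_iff.1 hu)))
  apply Subtype.ext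
  simp only [coe_lie, mul_smul_comm, smul_mul_assoc, ← smul_sub]
  have : (ξ : H →L[ℂ] H) * ((v : H →L[ℂ] H) * w - w * v) -
      ((v : H →L[ℂ] H) * w - w * v) * ξ = 0 := by
    rw [mul_sub, ← mul_assoc, ← mul_assoc, key v hv, key w hw, sub_mul, sub_mul, mul_assoc,
      mul_assoc, key v hv, key w hw]
    simp only [mul_sub, sub_mul, smul_mul_assoc, mul_smul_comm, mul_assoc]
    abel
  rw [this]
  simp

/-- The trilinear form `⟨u, [v, w]⟩` vanishes on tangent vectors. -/
theorem trInner_lie_eq_zero (h : IsScaledProjection ξ) {u v w : Herm H}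
    (hu : u ∈ orbitTangent ξ) (hv : v ∈ orbitTangent ξ) (hw : w ∈ orbitTangent ξ) :
    trInner u (lie v w) = 0 := by
  obtain ⟨A, rfl⟩ := hu
  simp only
  rw [trInner_lie, h.lie_self_lie hv hw]
  exact (trBilin H A).map_zero

end IsScaledProjection

end Algebra

/-! ### Subsets of a vector space with ambiently smooth charts -/

section Charts

variable {F : Type*} [NormedAddCommGroup F] [NormedSpace ℂ F]
  {E : Type*} [NormedAddCommGroup E] [NormedSpace ℝ E] {S : Set E}

/-- A chart of the subset `S` of `E` whose inverse is a smooth map from all of `F` to `E`, and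
which is near each point of its domain the restriction of a smooth map defined on `E`. -/
structure IsAmbientChart (e : OpenPartialHomeomorph S F) : Prop where
  target_eq : e.target = Set.univ
  contDiff_symm : ContDiff ℝ ∞ fun y => (e.symm y : E)
  exists_extension : ∃ φ : E → F, (∀ q ∈ e.source, ContDiffAt ℝ ∞ φ q) ∧
    ∀ q ∈ e.source, e q = φ q

/-- The parametrization of `S` that is inverse to the chart `e`, as a map into `E`. -/
def param (e : OpenPartialHomeomorph S F) (y : F) : E := e.symm y

namespace IsAmbientChart

variable {e e' : OpenPartialHomeomorph S F}

theorem mem_target (he : IsAmbientChart e) (y : F) : y ∈ e.target := by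
  rw [he.target_eq]; trivial

theorem symm_mem_source (he : IsAmbientChart e) (y : F) : e.symm y ∈ e.source :=
  e.map_target (he.mem_target y)

theorem contDiff_param (he : IsAmbientChart e) : ContDiff ℝ ∞ (param e) := he.contDiff_symm

theorem hasFDerivAt_param (he : IsAmbientChart e) (y : F) :
    HasFDerivAt (param e) (fderiv ℝ (param e) y) y :=
  (he.contDiff_param.differentiable (by simp) y).hasFDerivAt

/-- A transition map is the composition of a parametrization with the ambient extension of the
other chart. -/
theorem contDiffOn_transition (he : IsAmbientChart e) (he' : IsAmbientChart e') :
    ContDiffOn ℝ ∞ (e' ∘ e.symm) (e.symm ⁻¹' e'.source) := by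
  obtain ⟨φ, hφ, heq⟩ := he'.exists_extension
  have h : ContDiffOn ℝ ∞ (φ ∘ param e) (e.symm ⁻¹' e'.source) := fun y hy =>
    ((hφ _ hy).comp y he.contDiff_param.contDiffAt).contDiffWithinAt
  exact h.congr fun y hy => heq _ hy

/-- The ambient extension of the chart is a smooth left inverse of the parametrization. -/
theorem injective_fderiv_param (he : IsAmbientChart e) (y : F) :
    Function.Injective (fderiv ℝ (param e) y) := by
  obtain ⟨φ, hφ, heq⟩ := he.exists_extension
  have h1 : HasFDerivAt φ (fderiv ℝ φ (param e y)) (param e y) :=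
    ((hφ _ (he.symm_mem_source y)).differentiableAt (by simp)).hasFDerivAt
  have h2 := h1.comp y (he.hasFDerivAt_param y)
  have h3 : φ ∘ param e = id := by
    funext z
    exact (heq _ (he.symm_mem_source z)).symm.trans (e.right_inv (he.mem_target z))
  rw [h3] at h2
  have h4 := h2.unique (hasFDerivAt_id y)
  exact Function.LeftInverse.injective (g := fderiv ℝ φ (param e y)) fun v =>
    DFunLike.congr_fun h4 v

end IsAmbientChart

variable [ChartedSpace F S]

theorem isManifold_of_isAmbientChart (h : ∀ e ∈ atlas F S, IsAmbientChart e) :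
    IsManifold 𝓘(ℝ, F) ∞ S := by
  refine isManifold_of_contDiffOn _ _ _ fun e e' he he' => ?_
  have := (h e he).contDiffOn_transition (h e' he')
  refine this.mono ?_
  intro y hy
  simpa [(h e he).target_eq] using hy

theorem contMDiff_val_of_isAmbientChart (h : ∀ e ∈ atlas F S, IsAmbientChart e) :
    ContMDiff 𝓘(ℝ, F) 𝓘(ℝ, E) ∞ (Subtype.val : S → E) := by
  have := isManifold_of_isAmbientChart h
  intro p
  have he := h _ (chart_mem_atlas F p)
  have h1 : ContMDiffAt 𝓘(ℝ, F) 𝓘(ℝ, F) ∞ (chartAt F p) p :=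
    (contMDiffOn_chart (I := 𝓘(ℝ, F)) (n := ∞) (x := p)).contMDiffAt
      ((chartAt F p).open_source.mem_nhds (mem_chart_source F p))
  have h2 : ContMDiffAt 𝓘(ℝ, F) 𝓘(ℝ, E) ∞ (param (chartAt F p) ∘ chartAt F p) p :=
    (he.contDiff_param.contMDiff _).comp p h1
  refine h2.congr_of_eventuallyEq ?_
  filter_upwards [(chartAt F p).open_source.mem_nhds (mem_chart_source F p)] with q hq
  exact congrArg Subtype.val ((chartAt F p).left_inv hq).symm

variable {e : OpenPartialHomeomorph S F}

/-- As a vector of `E`, a coordinate vector field is a partial derivative of the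
parametrization. -/
theorem inclDeriv_coordVec (h : ∀ e ∈ atlas F S, IsAmbientChart e) (he : e ∈ atlas F S)
    (y u : F) : inclDeriv F (e.symm y) (coordVec e y u) = fderiv ℝ (param e) y u := by
  have := isManifold_of_isAmbientChart h
  have : IsManifold 𝓘(ℝ, F) 1 S := IsManifold.of_le (n := ∞) (by simp)
  have h1 : MDifferentiableAt 𝓘(ℝ, F) 𝓘(ℝ, E) (Subtype.val : S → E) (e.symm y) :=
    (contMDiff_val_of_isAmbientChart h).mdifferentiable (by simp) _
  have h2 : MDifferentiableAt 𝓘(ℝ, F) 𝓘(ℝ, F) e.symm y :=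
    mdifferentiableAt_atlas_symm he ((h e he).mem_target y)
  have h3 := mfderiv_comp y h1 h2
  have h4 : mfderiv 𝓘(ℝ, F) 𝓘(ℝ, E) (Subtype.val ∘ e.symm) y = fderiv ℝ (param e) y :=
    mfderiv_eq_fderiv
  rw [h4] at h3
  exact (DFunLike.congr_fun h3 u).symm

theorem chartDeriv_coordVec (h : ∀ e ∈ atlas F S, IsAmbientChart e) (he : e ∈ atlas F S)
    (y u : F) : chartDeriv e (e.symm y) (coordVec e y u) = u := by
  have := isManifold_of_isAmbientChart h
  have : IsManifold 𝓘(ℝ, F) 1 S := IsManifold.of_le (n := ∞) (by simp)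
  have h1 := (mdifferentiable_of_mem_atlas (I := 𝓘(ℝ, F)) he).comp_symm_deriv
    ((h e he).mem_target y)
  exact DFunLike.congr_fun h1 u

theorem coordVec_surjective (h : ∀ e ∈ atlas F S, IsAmbientChart e) (he : e ∈ atlas F S)
    (y : F) (v : RTangent F (e.symm y)) : ∃ u : F, coordVec e y u = v := by
  have := isManifold_of_isAmbientChart h
  have : IsManifold 𝓘(ℝ, F) 1 S := IsManifold.of_le (n := ∞) (by simp)
  have h1 := (mdifferentiable_of_mem_atlas (I := 𝓘(ℝ, F)) he).symm.mfderiv_bijective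
    ((h e he).mem_target y)
  exact h1.2 v

theorem exists_symm_eq {F : Type*} [TopologicalSpace F] {S : Type*} [TopologicalSpace S]
    [ChartedSpace F S] (p : S) :
    ∃ e ∈ atlas F S, ∃ y : F, p = e.symm y :=
  ⟨chartAt F p, chart_mem_atlas F p, chartAt F p p,
    ((chartAt F p).left_inv (mem_chart_source F p)).symm⟩

theorem injective_inclDeriv_of_isAmbientChart (h : ∀ e ∈ atlas F S, IsAmbientChart e) (p : S) :
    Function.Injective (inclDeriv F p) := by
  obtain ⟨e, he, y, rfl⟩ := exists_symm_eq (F := F) p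
  intro v w hvw
  obtain ⟨u, rfl⟩ := coordVec_surjective h he y v
  obtain ⟨u', rfl⟩ := coordVec_surjective h he y w
  rw [inclDeriv_coordVec h he, inclDeriv_coordVec h he] at hvw
  rw [(h e he).injective_fderiv_param y hvw]

theorem range_inclDeriv_symm (h : ∀ e ∈ atlas F S, IsAmbientChart e) (he : e ∈ atlas F S)
    (y : F) : Set.range (inclDeriv F (e.symm y)) = Set.range (fderiv ℝ (param e) y) := by
  ext v
  constructor
  · rintro ⟨w, rfl⟩
    obtain ⟨u, rfl⟩ := coordVec_surjective h he y w
    exact ⟨u, (inclDeriv_coordVec h he y u).symm⟩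
  · rintro ⟨u, rfl⟩
    exact ⟨_, inclDeriv_coordVec h he y u⟩

end Charts

/-! ### Closedness of a pulled back two-form with linear coefficients -/

section Closed

variable {F : Type*} [NormedAddCommGroup F] [NormedSpace ℝ F]
  {E : Type*} [NormedAddCommGroup E] [NormedSpace ℝ E]

theorem contDiff_bilinear_apply {E' G : Type*} [NormedAddCommGroup E'] [NormedSpace ℝ E']
    [NormedAddCommGroup G] [NormedSpace ℝ G] {n : WithTop ℕ∞} (B : E →L[ℝ] E' →L[ℝ] G)
    {f : F → E} {g : F → E'} (hf : ContDiff ℝ n f) (hg : ContDiff ℝ n g) :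
    ContDiff ℝ n fun y => B (f y) (g y) :=
  (B.contDiff.comp hf).clm_apply hg

/-- The derivative of the components of the pullback by `ψ` of the two-form
`(v, w) ↦ τ ξ (β v w)`. -/
theorem hasFDerivAt_pullback {τ : E →L[ℝ] E →L[ℝ] ℝ} {β : E →L[ℝ] E →L[ℝ] E} {ψ : F → E}
    (hψ : ContDiff ℝ 2 ψ) (y u v : F) : ∃ D : F →L[ℝ] ℝ,
      HasFDerivAt (fun z => τ (ψ z) (β (fderiv ℝ ψ z u) (fderiv ℝ ψ z v))) D y ∧
      ∀ w, D w = τ (fderiv ℝ ψ y w) (β (fderiv ℝ ψ y u) (fderiv ℝ ψ y v)) +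
        τ (ψ y) (β (fderiv ℝ (fderiv ℝ ψ) y w u) (fderiv ℝ ψ y v)) +
        τ (ψ y) (β (fderiv ℝ ψ y u) (fderiv ℝ (fderiv ℝ ψ) y w v)) := by
  have h1 : HasFDerivAt ψ (fderiv ℝ ψ y) y :=
    (hψ.differentiable (by simp) y).hasFDerivAt
  have h2 : HasFDerivAt (fderiv ℝ ψ) (fderiv ℝ (fderiv ℝ ψ) y) y :=
    ((hψ.fderiv_right (m := 1) (by norm_num)).differentiable (by simp) y).hasFDerivAt
  have hu := h2.clm_apply (hasFDerivAt_const u y)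
  have hv := h2.clm_apply (hasFDerivAt_const v y)
  have hβ := (β.hasFDerivAt.comp y hu).clm_apply hv
  have hτ := (τ.hasFDerivAt.comp y h1).clm_apply hβ
  refine ⟨_, hτ, fun w => ?_⟩
  simp
  ring

/-- The pullback of a two-form with linear coefficients is closed as soon as the trilinear
form `(u, v, w) ↦ τ u (β v w)` vanishes on the image of the derivative: the terms with second
derivatives cancel by their symmetry. -/
theorem exteriorDeriv_pullback {τ : E →L[ℝ] E →L[ℝ] ℝ} {β : E →L[ℝ] E →L[ℝ] E} {ψ : F → E}
    (hψ : ContDiff ℝ 2 ψ) (hβ : ∀ a b, β a b = -β b a) (y : F)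
    (h0 : ∀ u v w, τ (fderiv ℝ ψ y u) (β (fderiv ℝ ψ y v) (fderiv ℝ ψ y w)) = 0) (u v w : F) :
    fderiv ℝ (fun z => τ (ψ z) (β (fderiv ℝ ψ z v) (fderiv ℝ ψ z w))) y u -
      fderiv ℝ (fun z => τ (ψ z) (β (fderiv ℝ ψ z u) (fderiv ℝ ψ z w))) y v +
      fderiv ℝ (fun z => τ (ψ z) (β (fderiv ℝ ψ z u) (fderiv ℝ ψ z v))) y w = 0 := by
  obtain ⟨D₁, h₁, e₁⟩ := hasFDerivAt_pullback (τ := τ) (β := β) hψ y v w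
  obtain ⟨D₂, h₂, e₂⟩ := hasFDerivAt_pullback (τ := τ) (β := β) hψ y u w
  obtain ⟨D₃, h₃, e₃⟩ := hasFDerivAt_pullback (τ := τ) (β := β) hψ y u v
  have hs : ∀ a b, fderiv ℝ (fderiv ℝ ψ) y a b = fderiv ℝ (fderiv ℝ ψ) y b a :=
    fun a b => (hψ.contDiffAt.isSymmSndFDerivAt (by simp)) a b
  rw [h₁.fderiv, h₂.fderiv, h₃.fderiv, e₁, e₂, e₃, h0, h0, h0, hs v u, hs w u, hs w v,
    hβ (fderiv ℝ (fderiv ℝ ψ) y u w), hβ (fderiv ℝ (fderiv ℝ ψ) y u v) (fderiv ℝ ψ y w)]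
  simp only [map_neg]
  ring

end Closed

/-! ### The derivative of the momentum map -/

section Momentum

variable {H : Type*} [NormedAddCommGroup H] [InnerProductSpace ℂ H] [CompleteSpace H]

scoped instance [FiniteDimensional ℂ H] : FiniteDimensional ℝ (Herm H) :=
  let f : Herm H →ₗ[ℝ] (H →L[ℂ] H) :=
    { toFun := Subtype.val, map_add' := fun _ _ => rfl, map_smul' := fun _ _ => rfl }
  FiniteDimensional.of_injective f Subtype.val_injective

/-- The Hermitian operator `|x⟩⟨y| + |y⟩⟨x|`, the derivative of the momentum map at `x` in the
direction `y`. -/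
noncomputable def symOp (x y : H) : Herm H :=
  ⟨InnerProductSpace.rankOne ℂ x y + InnerProductSpace.rankOne ℂ y x, by
    change star _ = _
    rw [star_add, ContinuousLinearMap.star_eq_adjoint, ContinuousLinearMap.star_eq_adjoint,
      InnerProductSpace.adjoint_rankOne, InnerProductSpace.adjoint_rankOne, add_comm]⟩

theorem symOp_apply (x y z : H) :
    (symOp x y : H →L[ℂ] H) z = inner ℂ y z • x + inner ℂ x z • y := rfl

theorem momentum_apply (x z : H) : (momentum x : H →L[ℂ] H) z = inner ℂ x z • x := rfl

variable (H) in
/-- `symOp` as a real bilinear map. -/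
noncomputable def symBilin : H →ₗ[ℝ] H →ₗ[ℝ] Herm H :=
  LinearMap.mk₂ ℝ symOp
    (fun x x' y => by
      apply Subtype.ext
      ext z
      simp only [symOp_apply, AddSubgroup.coe_add, add_apply, inner_add_left,
        smul_add, add_smul]
      abel)
    (fun c x y => by
      apply Subtype.ext
      ext z
      simp only [symOp_apply, coe_smul_herm, smul_apply,
        ← Complex.coe_smul, inner_smul_left, Complex.conj_ofReal, smul_add, smul_smul,
        mul_comm])
    (fun x y y' => by
      apply Subtype.ext
      ext z
      simp only [symOp_apply, AddSubgroup.coe_add, add_apply, inner_add_left,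
        smul_add, add_smul]
      abel)
    (fun c x y => by
      apply Subtype.ext
      ext z
      simp only [symOp_apply, coe_smul_herm, smul_apply,
        ← Complex.coe_smul, inner_smul_left, Complex.conj_ofReal, smul_add, smul_smul,
        mul_comm])

theorem symOp_smul_right (c : ℝ) (x y : H) : symOp x (c • y) = c • symOp x y :=
  (symBilin H x).map_smul c y

theorem symOp_add_right (x y y' : H) : symOp x (y + y') = symOp x y + symOp x y' :=
  (symBilin H x).map_add y y'

theorem symOp_comm (x y : H) : symOp x y = symOp y x :=
  Subtype.ext (add_comm _ _)

theorem symOp_self (x : H) : symOp x x = (2 : ℝ) • momentum x := by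
  rw [two_smul]
  rfl

theorem symOp_smul_self (a : ℂ) (x : H) : symOp x (a • x) = (2 * a.re) • momentum x := by
  apply Subtype.ext
  ext z
  rw [symOp_apply, coe_smul_herm, smul_apply, momentum_apply,
    inner_smul_left, ← Complex.coe_smul, smul_smul, smul_smul, ← add_smul]
  congr 1
  have := Complex.add_conj a
  rw [← this]
  ring

theorem momentum_smul (c : ℂ) (x : H) : momentum (c • x) = (‖c‖ ^ 2) • momentum x := by
  apply Subtype.ext
  ext z
  rw [momentum_apply, coe_smul_herm, smul_apply, momentum_apply,
    inner_smul_left, ← Complex.coe_smul, smul_smul, smul_smul]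
  congr 1
  have := Complex.conj_mul' c
  push_cast
  rw [← this]
  ring

theorem norm_momentum (x : H) : ‖momentum x‖ = ‖x‖ ^ 2 := by
  change ‖InnerProductSpace.rankOne ℂ x x‖ = _
  rw [InnerProductSpace.norm_rankOne, sq]

theorem isScaledProjection_momentum {x : H} (hx : x ≠ 0) :
    IsScaledProjection (momentum x) where
  ne_zero := by rw [norm_momentum]; positivity
  mul_self := by
    ext z
    rw [mul_apply_eq_comp, smul_apply, momentum_apply,
      momentum_apply, norm_momentum, inner_smul_right, inner_self_eq_norm_sq_to_K,
      ← Complex.coe_smul, smul_smul]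
    congr 1
    push_cast
    exact mul_comm _ _

theorem isScaledProjection_of_mem_rankOneCone {ξ : Herm H} (h : ξ ∈ rankOneCone H) :
    IsScaledProjection ξ := by
  obtain ⟨x, hx, rfl⟩ := h
  exact isScaledProjection_momentum hx

variable {r : ℝ}

theorem rankOneOrbit_subset_rankOneCone (hr : 0 < r) : rankOneOrbit H r ⊆ rankOneCone H := by
  rintro _ ⟨x, hx, rfl⟩
  refine ⟨x, fun h0 => ?_, rfl⟩
  have hx' : ‖x‖ = r := hx
  rw [h0, norm_zero] at hx'
  exact hr.ne hx'

theorem norm_of_mem_rankOneOrbit {ξ : Herm H} (h : ξ ∈ rankOneOrbit H r) : ‖ξ‖ = r ^ 2 := by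
  obtain ⟨x, hx, rfl⟩ := h
  rw [norm_momentum, show ‖x‖ = r from hx]

theorem isScaledProjection_of_mem_rankOneOrbit (hr : 0 < r) {ξ : Herm H}
    (h : ξ ∈ rankOneOrbit H r) : IsScaledProjection ξ :=
  isScaledProjection_of_mem_rankOneCone (rankOneOrbit_subset_rankOneCone hr h)

theorem smul_momentum_mem_rankOneOrbit (hr : 0 < r) {x : H} (hx : x ≠ 0) :
    (r ^ 2 / ‖x‖ ^ 2) • momentum x ∈ rankOneOrbit H r := by
  have hx' : ‖x‖ ≠ 0 := norm_ne_zero_iff.2 hx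
  refine ⟨((r / ‖x‖ : ℝ) : ℂ) • x, ?_, ?_⟩
  · change ‖_‖ = r
    rw [norm_smul, Complex.norm_real, Real.norm_of_nonneg (by positivity)]
    field_simp
  · rw [momentum_smul, Complex.norm_real, Real.norm_of_nonneg (by positivity), div_pow]

theorem lie_momentum (A : Herm H) (x : H) :
    lie A (momentum x) = symOp x (-Complex.I • (A : H →L[ℂ] H) x) := by
  have hA : ∀ z, inner ℂ ((A : H →L[ℂ] H) x) z = inner ℂ x ((A : H →L[ℂ] H) z) := fun z => by
    have h : ContinuousLinearMap.adjoint (A : H →L[ℂ] H) = A := A.2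
    rw [← ContinuousLinearMap.adjoint_inner_right, h]
  apply Subtype.ext
  ext z
  rw [coe_lie, symOp_apply, smul_apply, sub_apply, mul_apply_eq_comp, mul_apply_eq_comp,
    momentum_apply, momentum_apply, map_smul, inner_smul_left, hA, map_neg, Complex.conj_I]
  module

/-- Up to a multiple of `μ(x)`, the bracket with `μ(x)` turns the derivative of `μ` at `x` in the
direction `z` into the one in the direction `-i z`. -/
theorem lie_symOp_momentum (x z : H) :
    lie (symOp x z) (momentum x) = (‖x‖ ^ 2) • symOp x (-Complex.I • z) +
      (-2 * (inner ℂ x z).im) • momentum x := by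
  rw [lie_momentum, symOp_apply, inner_self_eq_norm_sq_to_K, smul_add, symOp_add_right, smul_smul,
    smul_smul, symOp_smul_self, add_comm, mul_comm (-Complex.I), ← smul_smul]
  congr 1
  · rw [← symOp_smul_right, ← Complex.coe_smul]
    norm_cast
  · congr 1
    have h := congrArg Complex.im (inner_conj_symm z x)
    rw [Complex.conj_im] at h
    simp [← h]

theorem calJ_symOp {x : H} (hx : x ≠ 0) (z : H) :
    calJ (momentum x) (symOp x z) = symOp x (-Complex.I • z) +
      (-2 * (inner ℂ x z).im / ‖x‖ ^ 2) • momentum x := by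
  have hx' : ‖x‖ ≠ 0 := norm_ne_zero_iff.2 hx
  rw [calJ, lie_symOp_momentum, norm_momentum, smul_add, smul_smul, smul_smul,
    one_div_mul_cancel (pow_ne_zero 2 hx'), one_smul]
  congr 2
  ring

variable (H) in
/-- The Jordan product as a real bilinear map. -/
noncomputable def jordanBilin : Herm H →ₗ[ℝ] Herm H →ₗ[ℝ] Herm H :=
  LinearMap.mk₂ ℝ jordan
    (fun A A' B => by
      apply Subtype.ext
      simp only [coe_jordan, AddSubgroup.coe_add, add_mul, mul_add]
      abel)
    jordan_smul_left
    (fun A B B' => by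
      apply Subtype.ext
      simp only [coe_jordan, AddSubgroup.coe_add, add_mul, mul_add]
      abel)
    (fun c A B => by rw [jordan_comm, jordan_smul_left, jordan_comm])

variable [FiniteDimensional ℂ H]

variable (H) in
/-- The Lie bracket as a continuous bilinear map. -/
noncomputable def lieCLM : Herm H →L[ℝ] Herm H →L[ℝ] Herm H := (lieBilin H).toContinuousBilinearMap

variable (H) in
/-- The Jordan product as a continuous bilinear map. -/
noncomputable def jordanCLM : Herm H →L[ℝ] Herm H →L[ℝ] Herm H :=
  (jordanBilin H).toContinuousBilinearMap

variable (H) in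
/-- The trace scalar product as a continuous bilinear form. -/
noncomputable def trCLM : Herm H →L[ℝ] Herm H →L[ℝ] ℝ := (trBilin H).toContinuousBilinearMap

variable (H) in
/-- `symOp` as a continuous real bilinear map. -/
noncomputable def symCLM : H →L[ℝ] H →L[ℝ] Herm H := (symBilin H).toContinuousBilinearMap

theorem lieCLM_apply (A B : Herm H) : lieCLM H A B = lie A B := rfl

theorem symCLM_apply (x y : H) : symCLM H x y = symOp x y := rfl

theorem momentum_eq_symCLM : (momentum : H → Herm H) = fun x => (2⁻¹ : ℝ) • symCLM H x x := by
  funext x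
  rw [symCLM_apply, symOp_self, smul_smul, inv_mul_cancel₀ two_ne_zero, one_smul]

theorem contDiff_momentum : ContDiff ℝ ∞ (momentum : H → Herm H) := by
  have h : (momentum : H → Herm H) = fun x => symCLM H x ((2⁻¹ : ℝ) • x) := by
    funext x
    rw [map_smul, momentum_eq_symCLM]
  rw [h]
  exact (symCLM H).contDiff.clm_apply (contDiff_id.const_smul (2⁻¹ : ℝ))

theorem hasFDerivAt_momentum (x : H) : HasFDerivAt momentum (symCLM H x) x := by
  rw [momentum_eq_symCLM]
  refine (((symCLM H).hasFDerivAt.clm_apply (hasFDerivAt_id x)).const_smul (2⁻¹ : ℝ)).congr_fderiv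
    ?_
  ext1 y
  change (2⁻¹ : ℝ) • (symOp x y + symOp y x) = symOp x y
  rw [symOp_comm y x, ← two_smul ℝ, smul_smul, inv_mul_cancel₀ two_ne_zero, one_smul]

theorem fderiv_momentum (x y : H) : fderiv ℝ momentum x y = symOp x y := by
  rw [(hasFDerivAt_momentum x).fderiv, symCLM_apply]

theorem exists_calJ_fderiv_momentum {x : H} (hx : x ≠ 0) (y : H) : ∃ y' : H,
    calJ (momentum x) (fderiv ℝ momentum x y) = fderiv ℝ momentum x y' := by
  refine ⟨-Complex.I • y + (-2 * (inner ℂ x y).im / ‖x‖ ^ 2 / 2) • x, ?_⟩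
  rw [fderiv_momentum, fderiv_momentum, calJ_symOp hx, symOp_add_right, symOp_smul_right,
    symOp_self, smul_smul, div_mul_cancel₀ _ two_ne_zero]

theorem contDiffOn_calJ_momentum (A : Herm H) :
    ContDiffOn ℝ ∞ (fun x : H => calJ (momentum x) A) {x : H | x ≠ 0} := by
  have h : (fun x : H => calJ (momentum x) A) =
      fun x => (1 / ‖x‖ ^ 2) • lieCLM H A (momentum x) := by
    funext x
    rw [calJ, norm_momentum, lieCLM_apply]
  rw [h]
  refine ContDiffOn.smul (contDiffOn_const.div (contDiff_norm_sq ℂ).contDiffOn fun x hx => ?_)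
    ((lieCLM H A).contDiff.comp contDiff_momentum).contDiffOn
  exact pow_ne_zero 2 (norm_ne_zero_iff.2 hx)

/-! ### The orbit of a rank-one operator -/

/-- The index type is `Fin (n - 1 + 1)`, so that the basis vectors other than `u` are indexed by
`Fin (n - 1)`. -/
theorem exists_orthonormalBasis_zero_eq {H : Type*} [NormedAddCommGroup H]
    [InnerProductSpace ℂ H] [FiniteDimensional ℂ H] {u : H} (hu : ‖u‖ = 1) :
    ∃ b : OrthonormalBasis (Fin (Module.finrank ℂ H - 1 + 1)) ℂ H, b 0 = u := by
  have hu0 : u ≠ 0 := by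
    rintro rfl
    simp at hu
  have : Nontrivial H := ⟨⟨u, 0, hu0⟩⟩
  have hn : 0 < Module.finrank ℂ H := Module.finrank_pos
  have horth : Orthonormal ℂ
      (({0} : Set (Fin (Module.finrank ℂ H - 1 + 1))).domRestrict fun _ => u) :=
    ⟨fun _ => hu, fun i j hij => (hij (Subsingleton.elim i j)).elim⟩
  obtain ⟨b, hb⟩ := horth.exists_orthonormalBasis_extension_of_card_eq
    (by rw [Fintype.card_fin]; omega)
  exact ⟨b, hb 0 rfl⟩

/-- The unitary group acts transitively on spheres. -/
theorem exists_linearIsometryEquiv_apply_eq {H : Type*} [NormedAddCommGroup H]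
    [InnerProductSpace ℂ H] [FiniteDimensional ℂ H] {x y : H} (h : ‖x‖ = ‖y‖) (hx : x ≠ 0) :
    ∃ U : H ≃ₗᵢ[ℂ] H, U x = y := by
  have hx' : ‖x‖ ≠ 0 := norm_ne_zero_iff.2 hx
  have hn : ∀ z : H, ‖z‖ = ‖x‖ → ‖((‖x‖ : ℂ)⁻¹) • z‖ = 1 := fun z hz => by
    rw [norm_smul, norm_inv, Complex.norm_real, norm_norm, hz, inv_mul_cancel₀ hx']
  have hs : ∀ z : H, z = (‖x‖ : ℂ) • ((‖x‖ : ℂ)⁻¹) • z := fun z => by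
    rw [smul_smul, mul_inv_cancel₀ (by exact_mod_cast hx'), one_smul]
  obtain ⟨b, hb⟩ := exists_orthonormalBasis_zero_eq (hn x rfl)
  obtain ⟨c, hc⟩ := exists_orthonormalBasis_zero_eq (hn y h.symm)
  refine ⟨b.equiv c (Equiv.refl _), ?_⟩
  conv_lhs => rw [hs x]
  rw [map_smul, ← hb, OrthonormalBasis.equiv_apply_basis, Equiv.refl_apply, hc, ← hs]

theorem rankOneOrbit_eq_unitaryOrbit (hr : 0 < r) {ξ : Herm H} (h : ξ ∈ rankOneOrbit H r) :
    rankOneOrbit H r = unitaryOrbit ξ := by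
  obtain ⟨x, hx, rfl⟩ := h
  have hxr : ‖x‖ = r := hx
  have hx0 : x ≠ 0 := norm_ne_zero_iff.1 (by rw [hxr]; exact hr.ne')
  have key : ∀ U : H →L[ℂ] H,
      (momentum (U x) : H →L[ℂ] H) = U * (momentum x : H →L[ℂ] H) * star U := by
    intro U
    ext z
    rw [mul_apply_eq_comp, mul_apply_eq_comp, momentum_apply,
      momentum_apply, map_smul, ContinuousLinearMap.star_eq_adjoint,
      ContinuousLinearMap.adjoint_inner_right]
  ext ζ
  constructor
  · rintro ⟨y, hy, rfl⟩
    obtain ⟨U, rfl⟩ := exists_linearIsometryEquiv_apply_eq (hxr.trans (Eq.symm hy)) hx0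
    let V : unitary (H →L[ℂ] H) := Unitary.linearIsometryEquiv.symm U
    have hV : (V : H →L[ℂ] H) x = U x := rfl
    rw [← hV]
    exact ⟨V, V.2, key V⟩
  · rintro ⟨U, hU, hζ⟩
    refine ⟨U x, ?_, Subtype.ext ((key U).trans hζ.symm)⟩
    change ‖U x‖ = r
    rw [← hxr]
    exact ContinuousLinearMap.norm_map_of_mem_unitary hU x

end Momentum

/-! ### Affine charts of the orbit -/

section AffineChart

/-- An antilinear isomorphism of `F` with the orthogonal complement of the unit vector `u`:
`lift` is the isomorphism, and `coord` is its inverse precomposed with the orthogonal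
projection. Antilinearity is recorded as real linearity and anticommutation with `i`. -/
structure AntilinearFrame (F : Type*) [NormedAddCommGroup F] [NormedSpace ℂ F]
    {H : Type*} [NormedAddCommGroup H] [InnerProductSpace ℂ H] (u : H) where
  lift : F →L[ℝ] H
  coord : H →L[ℝ] F
  norm_base : ‖u‖ = 1
  lift_I : ∀ w, lift (Complex.I • w) = -(Complex.I • lift w)
  coord_I : ∀ z, coord (Complex.I • z) = -(Complex.I • coord z)
  inner_lift : ∀ w, inner ℂ u (lift w) = 0
  coord_lift : ∀ w, coord (lift w) = w
  lift_coord : ∀ z, lift (coord z) = z - inner ℂ u z • u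

theorem nonempty_antilinearFrame {H : Type*} [NormedAddCommGroup H] [InnerProductSpace ℂ H]
    [FiniteDimensional ℂ H] {u : H} (hu : ‖u‖ = 1) :
    Nonempty (AntilinearFrame (EuclideanSpace ℂ (Fin (Module.finrank ℂ H - 1))) u) := by
  -- the coordinates of `z` are the `⟨z, bᵢ⟩`, antilinear in `z`
  obtain ⟨b, hb⟩ := exists_orthonormalBasis_zero_eq hu
  let L : EuclideanSpace ℂ (Fin (Module.finrank ℂ H - 1)) →ₗ[ℝ] H :=
    { toFun := fun w => ∑ i, (starRingEnd ℂ) (w i) • b i.succ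
      map_add' := fun w w' => by
        simp only [PiLp.add_apply, map_add, add_smul, Finset.sum_add_distrib]
      map_smul' := fun c w => by
        simp only [← Complex.coe_smul, PiLp.smul_apply, smul_eq_mul, map_mul, Complex.conj_ofReal,
          mul_smul, Finset.smul_sum, RingHom.id_apply] }
  let C : H →ₗ[ℝ] EuclideanSpace ℂ (Fin (Module.finrank ℂ H - 1)) :=
    { toFun := fun z => WithLp.toLp 2 fun i => inner ℂ z (b i.succ)
      map_add' := fun z z' => by
        ext i
        simp only [inner_add_left, PiLp.add_apply]
      map_smul' := fun c z => by
        ext i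
        simp only [← Complex.coe_smul, PiLp.smul_apply, inner_smul_left, Complex.conj_ofReal,
          smul_eq_mul, RingHom.id_apply] }
  have hL : ∀ w, L w = ∑ i, (starRingEnd ℂ) (w i) • b i.succ := fun _ => rfl
  have hC : ∀ z i, C z i = inner ℂ z (b i.succ) := fun _ _ => rfl
  exact ⟨{
    lift := LinearMap.toContinuousLinearMap L
    coord := LinearMap.toContinuousLinearMap C
    norm_base := hu
    lift_I := fun w => by
      simp only [LinearMap.coe_toContinuousLinearMap', hL, PiLp.smul_apply, smul_eq_mul, map_mul,
        Complex.conj_I, Finset.smul_sum, smul_smul, neg_mul, neg_smul, Finset.sum_neg_distrib]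
    coord_I := fun z => by
      ext i
      simp only [LinearMap.coe_toContinuousLinearMap', hC, PiLp.neg_apply, PiLp.smul_apply,
        smul_eq_mul, inner_smul_left, Complex.conj_I, neg_mul]
    inner_lift := fun w => by
      simp only [LinearMap.coe_toContinuousLinearMap', hL, inner_sum, inner_smul_right, ← hb,
        b.inner_eq_ite, (Fin.succ_ne_zero _).symm, if_false, mul_zero, Finset.sum_const_zero]
    coord_lift := fun w => by
      ext i
      simp only [LinearMap.coe_toContinuousLinearMap', hC, hL, sum_inner, inner_smul_left,
        b.inner_eq_ite, Fin.succ_inj, Complex.conj_conj, mul_ite, mul_one, mul_zero,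
        Finset.sum_ite_eq', Finset.mem_univ, if_true]
    lift_coord := fun z => by
      simp only [LinearMap.coe_toContinuousLinearMap', hL, hC, inner_conj_symm]
      rw [eq_sub_iff_add_eq, ← hb, add_comm]
      conv_rhs => rw [← b.sum_repr' z, Fin.sum_univ_succ] }⟩

namespace AntilinearFrame

variable {F : Type*} [NormedAddCommGroup F] [NormedSpace ℂ F]
  {H : Type*} [NormedAddCommGroup H] [InnerProductSpace ℂ H] {u : H}

theorem inner_base_add_lift (Φ : AntilinearFrame F u) (y : F) :
    inner ℂ u (u + Φ.lift y) = 1 := by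
  rw [inner_add_right, Φ.inner_lift, add_zero, inner_self_eq_norm_sq_to_K, Φ.norm_base]
  norm_num

theorem base_add_lift_ne_zero (Φ : AntilinearFrame F u) (y : F) : u + Φ.lift y ≠ 0 := by
  intro h
  have := Φ.inner_base_add_lift y
  rw [h, inner_zero_right] at this
  exact zero_ne_one this

theorem coord_base (Φ : AntilinearFrame F u) : Φ.coord u = 0 := by
  rw [← Φ.coord_lift (Φ.coord u), Φ.lift_coord, inner_self_eq_norm_sq_to_K, Φ.norm_base]
  norm_num

theorem coord_smul (Φ : AntilinearFrame F u) (c : ℂ) (z : H) :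
    Φ.coord (c • z) = (starRingEnd ℂ) c • Φ.coord z := by
  conv_lhs => rw [← Complex.re_add_im c]
  rw [add_smul, mul_smul, map_add, Complex.coe_smul, map_smul, Complex.coe_smul, map_smul,
    Φ.coord_I, ← Complex.coe_smul, ← Complex.coe_smul, ← neg_smul, smul_smul, ← add_smul]
  congr 1
  apply Complex.ext <;> simp

variable [CompleteSpace H]

/-- The affine coordinates of a rank-one operator `|x⟩⟨x|`: those of the point `x / ⟨u, x⟩` of
the affine hyperplane `⟨u, ·⟩ = 1`. They are written in terms of the operator `ξ = |x⟩⟨x|`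
itself, through `ξ u = ⟨x, u⟩ x`. -/
noncomputable def affineCoord (Φ : AntilinearFrame F u) (ξ : Herm H) : F :=
  (inner ℂ u ((ξ : H →L[ℂ] H) u)).re⁻¹ • Φ.coord ((ξ : H →L[ℂ] H) u)

/-- The rank-one operator of norm `r ^ 2` with given affine coordinates. -/
noncomputable def affineParam (Φ : AntilinearFrame F u) (r : ℝ) (y : F) : Herm H :=
  (r ^ 2 / ‖u + Φ.lift y‖ ^ 2) • momentum (u + Φ.lift y)

theorem inner_momentum (u x : H) :
    (inner ℂ u ((momentum x : H →L[ℂ] H) u)).re = ‖inner ℂ u x‖ ^ 2 := by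
  rw [momentum_apply, inner_smul_right, ← inner_conj_symm x u, Complex.conj_mul']
  norm_cast

theorem affineCoord_smul (Φ : AntilinearFrame F u) {c : ℝ} (hc : c ≠ 0) (ξ : Herm H) :
    Φ.affineCoord (c • ξ) = Φ.affineCoord ξ := by
  have h : inner ℂ u (c • (ξ : H →L[ℂ] H) u) = (c : ℂ) * inner ℂ u ((ξ : H →L[ℂ] H) u) := by
    rw [← Complex.coe_smul, inner_smul_right]
  simp only [affineCoord, coe_smul_herm, smul_apply, map_smul]
  rw [h, Complex.re_ofReal_mul, smul_smul]
  congr 1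
  field_simp

theorem affineCoord_momentum (Φ : AntilinearFrame F u) {x : H} (hx : inner ℂ u x ≠ 0) :
    Φ.affineCoord (momentum x) = Φ.coord ((inner ℂ u x)⁻¹ • x) := by
  rw [affineCoord, inner_momentum, momentum_apply, Φ.coord_smul, Φ.coord_smul, inner_conj_symm,
    ← Complex.coe_smul, smul_smul]
  congr 1
  push_cast
  rw [← Complex.conj_mul', map_inv₀]
  have : (starRingEnd ℂ) (inner ℂ u x) ≠ 0 := (map_ne_zero _).2 hx
  field_simp

theorem affineCoord_affineParam (Φ : AntilinearFrame F u) {r : ℝ} (hr : 0 < r) (y : F) :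
    Φ.affineCoord (Φ.affineParam r y) = y := by
  have h : ‖u + Φ.lift y‖ ≠ 0 := norm_ne_zero_iff.2 (Φ.base_add_lift_ne_zero y)
  rw [affineParam, Φ.affineCoord_smul (by positivity), Φ.affineCoord_momentum,
    Φ.inner_base_add_lift, inv_one, one_smul, map_add, Φ.coord_base, Φ.coord_lift, zero_add]
  rw [Φ.inner_base_add_lift]
  exact one_ne_zero

/-- The affine coordinates determine a rank-one operator up to normalization. -/
theorem affineParam_affineCoord (Φ : AntilinearFrame F u) (r : ℝ) {x : H}
    (hx : inner ℂ u x ≠ 0) : Φ.affineParam r (Φ.affineCoord (momentum x)) =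
      (r ^ 2 / ‖x‖ ^ 2) • momentum x := by
  have hn : ‖inner ℂ u x‖ ≠ 0 := norm_ne_zero_iff.2 hx
  have h : u + Φ.lift ((Φ.affineCoord (momentum x))) = (inner ℂ u x)⁻¹ • x := by
    rw [Φ.affineCoord_momentum hx, Φ.lift_coord, inner_smul_right, inv_mul_cancel₀ hx, one_smul]
    abel
  rw [affineParam, h, momentum_smul, smul_smul, norm_smul, norm_inv]
  congr 1
  field_simp

theorem affineParam_mem (Φ : AntilinearFrame F u) {r : ℝ} (hr : 0 < r) (y : F) :
    Φ.affineParam r y ∈ rankOneOrbit H r :=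
  smul_momentum_mem_rankOneOrbit hr (Φ.base_add_lift_ne_zero y)

theorem isScaledProjection_affineParam (Φ : AntilinearFrame F u) {r : ℝ} (hr : 0 < r) (y : F) :
    IsScaledProjection (Φ.affineParam r y) :=
  isScaledProjection_of_mem_rankOneOrbit hr (Φ.affineParam_mem hr y)

theorem calJ_affineParam (Φ : AntilinearFrame F u) {r : ℝ} (hr : 0 < r) (y : F) (A : Herm H) :
    calJ (Φ.affineParam r y) A = calJ (momentum (u + Φ.lift y)) A :=
  have := norm_pos_iff.2 (Φ.base_add_lift_ne_zero y)
  calJ_smul_base (by positivity) _ _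

theorem inner_affineParam_ne_zero (Φ : AntilinearFrame F u) {r : ℝ} (hr : 0 < r) (y : F) :
    (inner ℂ u ((Φ.affineParam r y : H →L[ℂ] H) u)).re ≠ 0 := by
  have h : ‖u + Φ.lift y‖ ≠ 0 := norm_ne_zero_iff.2 (Φ.base_add_lift_ne_zero y)
  rw [affineParam, coe_smul_herm, smul_apply, ← Complex.coe_smul, inner_smul_right,
    Complex.re_ofReal_mul, inner_momentum, Φ.inner_base_add_lift]
  simp only [norm_one, one_pow, mul_one]
  positivity

/-- Evaluation of Hermitian operators at `u`, as a continuous real linear map. -/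
noncomputable def evalAt (u : H) : Herm H →L[ℝ] H where
  toFun ξ := (ξ : H →L[ℂ] H) u
  map_add' _ _ := rfl
  map_smul' _ _ := rfl
  cont := (ContinuousLinearMap.apply ℂ H u).continuous.comp continuous_subtype_val

/-- The real linear form `ξ ↦ ⟨u, ξ u⟩` on Hermitian operators (its values are real, and the
real part is taken to have them in `ℝ`). -/
noncomputable def diagEntry (u : H) : Herm H →L[ℝ] ℝ :=
  Complex.reCLM.comp (((innerSL ℂ u).restrictScalars ℝ).comp (evalAt u))

theorem diagEntry_apply (u : H) (ξ : Herm H) :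
    diagEntry u ξ = (inner ℂ u ((ξ : H →L[ℂ] H) u)).re := rfl

theorem contDiffAt_affineCoord (Φ : AntilinearFrame F u) {ξ : Herm H} (h : diagEntry u ξ ≠ 0) :
    ContDiffAt ℝ ∞ Φ.affineCoord ξ :=
  ((diagEntry u).contDiff.contDiffAt.inv h).smul
    (Φ.coord.contDiff.comp (evalAt u).contDiff).contDiffAt

theorem contDiff_affineParam [FiniteDimensional ℂ H] (Φ : AntilinearFrame F u) (r : ℝ) :
    ContDiff ℝ ∞ (Φ.affineParam r) := by
  have h : ContDiff ℝ ∞ fun y => u + Φ.lift y := contDiff_const.add Φ.lift.contDiff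
  refine ContDiff.smul (contDiff_const.div ((contDiff_norm_sq ℂ).comp h) fun y => ?_)
    (contDiff_momentum.comp h)
  exact pow_ne_zero 2 (norm_ne_zero_iff.2 (Φ.base_add_lift_ne_zero y))

/-- The affine chart of `D¹_r(H)` on the set of the `|x⟩⟨x|` with `⟨u, x⟩ ≠ 0`. -/
noncomputable def affineChart [FiniteDimensional ℂ H] (Φ : AntilinearFrame F u) {r : ℝ}
    (hr : 0 < r) : OpenPartialHomeomorph (rankOneOrbit H r) F where
  toFun ξ := Φ.affineCoord ξ
  invFun y := ⟨Φ.affineParam r y, Φ.affineParam_mem hr y⟩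
  source := {ξ | diagEntry u ξ ≠ 0}
  target := Set.univ
  map_source' _ _ := trivial
  map_target' y _ := Φ.inner_affineParam_ne_zero hr y
  left_inv' := by
    rintro ⟨_, x, hx, rfl⟩ h
    have hx' : ‖x‖ = r := hx
    have h' : inner ℂ u x ≠ 0 := by
      intro h0
      apply h
      change diagEntry u (momentum x) = 0
      rw [diagEntry_apply, inner_momentum, h0, norm_zero, zero_pow two_ne_zero]
    apply Subtype.ext
    change Φ.affineParam r (Φ.affineCoord (momentum x)) = momentum x
    rw [Φ.affineParam_affineCoord r h', hx', div_self (by positivity), one_smul]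
  right_inv' y _ := Φ.affineCoord_affineParam hr y
  open_source := isOpen_ne_fun ((diagEntry u).continuous.comp continuous_subtype_val)
    continuous_const
  open_target := isOpen_univ
  continuousOn_toFun := fun ξ hξ =>
    ((Φ.contDiffAt_affineCoord hξ).continuousAt.comp
      continuous_subtype_val.continuousAt).continuousWithinAt
  continuousOn_invFun := by
    refine (Continuous.subtype_mk ?_ _).continuousOn
    exact (Φ.contDiff_affineParam r).continuous

end AntilinearFrame
end AffineChart

/-! ### Tangent vectors and the complex structure in affine coordinates -/

section AffineTangent

namespace AntilinearFrame

variable {F : Type*} [NormedAddCommGroup F] [NormedSpace ℂ F]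
  {H : Type*} [NormedAddCommGroup H] [InnerProductSpace ℂ H] [FiniteDimensional ℂ H]
  [CompleteSpace H] {u : H} {r : ℝ}

theorem differentiableAt_affineParam (Φ : AntilinearFrame F u) (r : ℝ) (y : F) :
    DifferentiableAt ℝ (Φ.affineParam r) y :=
  (Φ.contDiff_affineParam r).differentiable (by simp) y

/-- Up to a multiple of the base point, the derivative of the parametrization is `symOp` of the
lift. -/
theorem exists_fderiv_affineParam (Φ : AntilinearFrame F u) (r : ℝ) (y h : F) : ∃ c : ℝ,
    fderiv ℝ (Φ.affineParam r) y h =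
      (r ^ 2 / ‖u + Φ.lift y‖ ^ 2) • symOp (u + Φ.lift y) (Φ.lift h) +
        c • momentum (u + Φ.lift y) := by
  have h1 : HasFDerivAt (fun y => u + Φ.lift y) Φ.lift y := Φ.lift.hasFDerivAt.const_add u
  have h2 := (hasFDerivAt_momentum (u + Φ.lift y)).comp y h1
  have h0 : ContDiff ℝ 1 fun y => r ^ 2 / ‖u + Φ.lift y‖ ^ 2 :=
    contDiff_const.div ((contDiff_norm_sq ℂ).comp (contDiff_const.add Φ.lift.contDiff))
      fun y => pow_ne_zero 2 (norm_ne_zero_iff.2 (Φ.base_add_lift_ne_zero y))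
  have h3 := h0.differentiable (by simp) y
  have h4 := h3.hasFDerivAt.smul h2
  exact ⟨_, DFunLike.congr_fun h4.fderiv h⟩

/-- The derivative of the equation `ξ ^ 2 = r ^ 2 ξ` satisfied by the parametrized operators
is the equation of the tangent space. -/
theorem fderiv_affineParam_mem (Φ : AntilinearFrame F u) (hr : 0 < r) (y h : F) :
    fderiv ℝ (Φ.affineParam r) y h ∈ orbitTangent (Φ.affineParam r y) := by
  rw [(Φ.isScaledProjection_affineParam hr y).mem_orbitTangent_iff,
    norm_of_mem_rankOneOrbit (Φ.affineParam_mem hr y)]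
  have h1 := (Φ.differentiableAt_affineParam r y).hasFDerivAt
  have h2 := (jordanCLM H).hasFDerivAt_of_bilinear h1 h1
  have h3 : (fun y => jordanCLM H (Φ.affineParam r y) (Φ.affineParam r y)) =
      fun y => (2 * r ^ 2) • Φ.affineParam r y := by
    funext z
    change jordan _ _ = _
    apply Subtype.ext
    rw [coe_jordan, (Φ.isScaledProjection_affineParam hr z).mul_self,
      norm_of_mem_rankOneOrbit (Φ.affineParam_mem hr z), coe_smul_herm, ← add_smul, two_mul]
  rw [h3] at h2
  have h5 := h1.const_smul (2 * r ^ 2)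
  have h6 := h2.unique h5
  have h4 : jordan (Φ.affineParam r y) (fderiv ℝ (Φ.affineParam r) y h) +
      jordan (fderiv ℝ (Φ.affineParam r) y h) (Φ.affineParam r y) =
      (2 * r ^ 2) • fderiv ℝ (Φ.affineParam r) y h :=
    DFunLike.congr_fun h6 h
  rw [jordan_comm (Φ.affineParam r y), ← two_smul ℝ, mul_smul] at h4
  exact smul_right_injective _ (two_ne_zero (α := ℝ)) h4

/-- The brackets with a parametrized operator are the derivatives of the parametrization. -/
theorem range_fderiv_affineParam (Φ : AntilinearFrame F u) (hr : 0 < r) (y : F) :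
    Set.range (fderiv ℝ (Φ.affineParam r) y) = orbitTangent (Φ.affineParam r y) := by
  apply Set.Subset.antisymm
  · rintro _ ⟨h, rfl⟩
    exact Φ.fderiv_affineParam_mem hr y h
  · rintro _ ⟨A, rfl⟩
    set x := u + Φ.lift y with hx
    obtain ⟨z, hz⟩ : ∃ z, z = -Complex.I • (A : H →L[ℂ] H) x := ⟨_, rfl⟩
    obtain ⟨w, hw⟩ : ∃ w, z = inner ℂ u z • x + Φ.lift w := by
      refine ⟨Φ.coord (z - inner ℂ u z • x), ?_⟩
      rw [Φ.lift_coord, inner_sub_right, inner_smul_right, hx, Φ.inner_base_add_lift]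
      simp
    have hs : symOp x z = (2 * (inner ℂ u z).re) • momentum x + symOp x (Φ.lift w) := by
      conv_lhs => rw [hw, symOp_add_right, symOp_smul_self]
    have hA : lie A (Φ.affineParam r y) = (r ^ 2 / ‖x‖ ^ 2) • symOp x z := by
      rw [affineParam, lie_smul_right, lie_momentum, hz]
    obtain ⟨c, hc⟩ := Φ.exists_fderiv_affineParam r y w
    refine ⟨w, ?_⟩
    -- both sides agree up to a multiple of `μ(x)`, which `𝒥` kills
    apply (Φ.isScaledProjection_affineParam hr y).eq_of_calJ_eq
      (Φ.fderiv_affineParam_mem hr y w) (lie_mem_orbitTangent _ A)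
    rw [hA, hs, hc, Φ.calJ_affineParam hr, Φ.calJ_affineParam hr]
    simp only [← hx, calJ_add, calJ_smul, calJ_self, smul_add, smul_zero, add_zero, zero_add]

/-- In affine coordinates `𝒥` is multiplication by `i`. -/
theorem calJ_fderiv_affineParam (Φ : AntilinearFrame F u) (hr : 0 < r) (y h : F) :
    calJ (Φ.affineParam r y) (fderiv ℝ (Φ.affineParam r) y h) =
      fderiv ℝ (Φ.affineParam r) y (Complex.I • h) := by
  obtain ⟨c, hc⟩ := Φ.exists_fderiv_affineParam r y h
  obtain ⟨c', hc'⟩ := Φ.exists_fderiv_affineParam r y (Complex.I • h)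
  apply (Φ.isScaledProjection_affineParam hr y).eq_of_calJ_eq
    (calJ_mem_orbitTangent _ _) (Φ.fderiv_affineParam_mem hr y _)
  rw [hc, hc', Φ.calJ_affineParam hr, Φ.calJ_affineParam hr, Φ.calJ_affineParam hr, calJ_add,
    calJ_smul, calJ_symOp (Φ.base_add_lift_ne_zero y), Φ.lift_I]
  simp only [calJ_add, calJ_smul, calJ_self, smul_zero, add_zero, smul_add, neg_smul]

theorem isAmbientChart_affineChart (Φ : AntilinearFrame F u) (hr : 0 < r) :
    IsAmbientChart (Φ.affineChart hr) where
  target_eq := rfl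
  contDiff_symm := Φ.contDiff_affineParam r
  exists_extension := ⟨Φ.affineCoord, fun _ hq => Φ.contDiffAt_affineCoord hq, fun _ _ => rfl⟩

end AntilinearFrame

end AffineTangent

/-! ### The Kähler structure of the orbit -/

/-- The hypotheses on an atlas under which the orbit is a Kähler manifold: its charts are smooth
in the ambient sense, their parametrizations have the brackets as tangent vectors, and `𝒥` is
multiplication by `i` in them. -/
structure IsHolomorphicAtlas (F : Type*) [NormedAddCommGroup F] [NormedSpace ℂ F]
    (H : Type*) [NormedAddCommGroup H] [InnerProductSpace ℂ H] [CompleteSpace H] (r : ℝ)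
    [ChartedSpace F (rankOneOrbit H r)] : Prop where
  isAmbientChart : ∀ e ∈ atlas F (rankOneOrbit H r), IsAmbientChart e
  range_fderiv : ∀ e ∈ atlas F (rankOneOrbit H r), ∀ y,
    Set.range (fderiv ℝ (param e) y) = orbitTangent (param e y)
  calJ_fderiv : ∀ e ∈ atlas F (rankOneOrbit H r), ∀ y h,
    calJ (param e y) (fderiv ℝ (param e) y h) = fderiv ℝ (param e) y (Complex.I • h)

section Kahler

variable {H : Type*} [NormedAddCommGroup H] [InnerProductSpace ℂ H] [CompleteSpace H]
  [FiniteDimensional ℂ H] {r : ℝ}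

/-- The affine charts cover the orbit: at `|x⟩⟨x|`, take `u = x / r`. -/
theorem exists_antilinearFrame_mem_source (hr : 0 < r) (p : rankOneOrbit H r) :
    ∃ (u : H) (Φ : AntilinearFrame (EuclideanSpace ℂ (Fin (Module.finrank ℂ H - 1))) u),
      p ∈ (Φ.affineChart hr).source := by
  obtain ⟨_, x, hx, rfl⟩ := p
  have hx' : ‖x‖ = r := hx
  have hn : ‖((r : ℂ)⁻¹) • x‖ = 1 := by
    rw [norm_smul, norm_inv, Complex.norm_real, Real.norm_of_nonneg hr.le, hx',
      inv_mul_cancel₀ hr.ne']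
  obtain ⟨Φ⟩ := nonempty_antilinearFrame hn
  refine ⟨_, Φ, ?_⟩
  change AntilinearFrame.diagEntry _ (momentum x) ≠ 0
  have hr' : (r : ℂ) ≠ 0 := by exact_mod_cast hr.ne'
  rw [AntilinearFrame.diagEntry_apply, AntilinearFrame.inner_momentum, inner_smul_left,
    inner_self_eq_norm_sq_to_K, hx']
  simp [hr.ne']

/-- The orbit `D¹_r(H)` with all its affine charts. -/
noncomputable abbrev rankOneOrbitChartedSpace (hr : 0 < r) :
    ChartedSpace (EuclideanSpace ℂ (Fin (Module.finrank ℂ H - 1))) (rankOneOrbit H r) where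
  atlas := {e | ∃ (u : H)
    (Φ : AntilinearFrame (EuclideanSpace ℂ (Fin (Module.finrank ℂ H - 1))) u),
      e = Φ.affineChart hr}
  chartAt p := (exists_antilinearFrame_mem_source hr p).choose_spec.choose.affineChart hr
  mem_chart_source p := (exists_antilinearFrame_mem_source hr p).choose_spec.choose_spec
  chart_mem_atlas _ := ⟨_, _, rfl⟩

theorem isHolomorphicAtlas_affineCharts (hr : 0 < r) :
    letI := rankOneOrbitChartedSpace (H := H) hr
    IsHolomorphicAtlas (EuclideanSpace ℂ (Fin (Module.finrank ℂ H - 1))) H r := by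
  let _ := rankOneOrbitChartedSpace (H := H) hr
  refine ⟨?_, ?_, ?_⟩
  · rintro _ ⟨u, Φ, rfl⟩
    exact Φ.isAmbientChart_affineChart hr
  · rintro _ ⟨u, Φ, rfl⟩
    exact Φ.range_fderiv_affineParam hr
  · rintro _ ⟨u, Φ, rfl⟩
    exact Φ.calJ_fderiv_affineParam hr

end Kahler

section KahlerOfCharts

variable {F : Type*} [NormedAddCommGroup F] [NormedSpace ℂ F]
  {H : Type*} [NormedAddCommGroup H] [InnerProductSpace ℂ H] [CompleteSpace H]
  {r : ℝ} [ChartedSpace F (rankOneOrbit H r)]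

namespace IsHolomorphicAtlas

section Parametrizations

variable {e : OpenPartialHomeomorph (rankOneOrbit H r) F}

theorem contDiff_param (h : IsHolomorphicAtlas F H r) (he : e ∈ atlas F (rankOneOrbit H r)) :
    ContDiff ℝ ∞ (param e) := (h.isAmbientChart e he).contDiff_param

theorem contDiff_fderiv_param_apply (h : IsHolomorphicAtlas F H r)
    (he : e ∈ atlas F (rankOneOrbit H r)) (u : F) :
    ContDiff ℝ ∞ fun y => fderiv ℝ (param e) y u :=
  ((h.contDiff_param he).fderiv_right (m := ∞) (by simp)).clm_apply contDiff_const

theorem fderiv_param_mem (h : IsHolomorphicAtlas F H r) (he : e ∈ atlas F (rankOneOrbit H r))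
    (y u : F) : fderiv ℝ (param e) y u ∈ orbitTangent (param e y) := by
  rw [← h.range_fderiv e he]
  exact ⟨u, rfl⟩

end Parametrizations

variable [FiniteDimensional ℂ F]

theorem isEmbeddedSubmanifold (h : IsHolomorphicAtlas F H r) :
    IsEmbeddedSubmanifold F (rankOneOrbit H r) orbitTangent where
  isManifold := isManifold_of_isAmbientChart h.isAmbientChart
  contMDiff_incl := contMDiff_val_of_isAmbientChart h.isAmbientChart
  injective_inclDeriv := injective_inclDeriv_of_isAmbientChart h.isAmbientChart
  range_inclDeriv p := by
    obtain ⟨e, he, y, rfl⟩ := exists_symm_eq (F := F) p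
    rw [range_inclDeriv_symm h.isAmbientChart he, h.range_fderiv e he]
    rfl

theorem inclDeriv_mem (h : IsHolomorphicAtlas F H r) (p : rankOneOrbit H r)
    (v : RTangent F p) : inclDeriv F p v ∈ orbitTangent (p : Herm H) := by
  rw [← h.isEmbeddedSubmanifold.range_inclDeriv p]
  exact ⟨v, rfl⟩

/-- The restriction of `𝒥` to the tangent spaces of the orbit. -/
theorem exists_restrict_calJ (h : IsHolomorphicAtlas F H r) (p : rankOneOrbit H r) :
    ∃ J : RTangent F p →L[ℝ] RTangent F p,
      ∀ v, inclDeriv F p (J v) = calJ (p : Herm H) (inclDeriv F p v) := by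
  let ι : F →ₗ[ℝ] Herm H := (inclDeriv F p : F →L[ℝ] Herm H).toLinearMap
  obtain ⟨g, hg⟩ := ι.exists_leftInverse_of_injective
    (LinearMap.ker_eq_bot.2 (h.isEmbeddedSubmanifold.injective_inclDeriv p))
  have hg' : ∀ v, g (ι v) = v := fun v => DFunLike.congr_fun hg v
  let j : Herm H →ₗ[ℝ] Herm H := (1 / ‖(p : Herm H)‖) • (lieBilin H).flip p
  let J : F →L[ℝ] F := LinearMap.toContinuousLinearMap (g.comp (j.comp ι))
  refine ⟨J, fun v => ?_⟩
  have hmem : calJ (p : Herm H) (inclDeriv F p v) ∈ Set.range (inclDeriv F p) := by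
    rw [h.isEmbeddedSubmanifold.range_inclDeriv p]
    exact calJ_mem_orbitTangent _ _
  obtain ⟨w, hw⟩ := hmem
  have hJ : J v = w := by
    change g (calJ (p : Herm H) (inclDeriv F p v)) = w
    rw [← hw]
    exact hg' w
  exact (congrArg (inclDeriv F p) hJ).trans hw

/-- The restriction of `η` to the tangent spaces of the orbit. -/
theorem exists_kksForm (h : IsHolomorphicAtlas F H r) (hr : 0 < r) (p : rankOneOrbit H r) :
    ∃ η : RTangent F p →L[ℝ] RTangent F p →L[ℝ] ℝ,
      ∀ v w, η v w = kksForm (p : Herm H) (inclDeriv F p v) (inclDeriv F p w) := by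
  let ι : F →L[ℝ] Herm H := inclDeriv F p
  let η : F →L[ℝ] F →L[ℝ] ℝ := LinearMap.toContinuousBilinearMap
    ((-(‖(p : Herm H)‖ ^ 2)⁻¹) • ((lieBilin H).compr₂ (trBilin H p)).compl₁₂
      ι.toLinearMap ι.toLinearMap)
  refine ⟨η, fun v w => ?_⟩
  rw [(isScaledProjection_of_mem_rankOneOrbit hr p.2).kksForm_eq (h.inclDeriv_mem p v)
    (h.inclDeriv_mem p w)]
  rfl

section Tensors

variable {J : ∀ p : rankOneOrbit H r, RTangent F p →L[ℝ] RTangent F p}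
  {g η : ∀ p : rankOneOrbit H r, RTangent F p →L[ℝ] RTangent F p →L[ℝ] ℝ}
  {e : OpenPartialHomeomorph (rankOneOrbit H r) F}

/-- In the charts of the atlas, `J` is the constant endomorphism `i`. -/
theorem apply_coordVec (h : IsHolomorphicAtlas F H r)
    (hJ : ∀ p v, inclDeriv F p (J p v) = calJ (p : Herm H) (inclDeriv F p v))
    (he : e ∈ atlas F (rankOneOrbit H r)) (y u : F) :
    J (e.symm y) (coordVec e y u) = coordVec e y (Complex.I • u) := by
  apply h.isEmbeddedSubmanifold.injective_inclDeriv
  rw [hJ, inclDeriv_coordVec h.isAmbientChart he, inclDeriv_coordVec h.isAmbientChart he]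
  exact h.calJ_fderiv e he y u

theorem isComplexStructure (h : IsHolomorphicAtlas F H r) (hr : 0 < r)
    (hJ : ∀ p v, inclDeriv F p (J p v) = calJ (p : Herm H) (inclDeriv F p v)) :
    IsComplexStructure J where
  smooth e he u := by
    refine (contDiffOn_const (c := Complex.I • u)).congr fun y _ => ?_
    rw [endoInChart, h.apply_coordVec hJ he, chartDeriv_coordVec h.isAmbientChart he]
  sq p v := by
    apply h.isEmbeddedSubmanifold.injective_inclDeriv p
    rw [hJ, hJ, (isScaledProjection_of_mem_rankOneOrbit hr p.2).calJ_calJ (h.inclDeriv_mem p v),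
      map_neg]
  integrable p := by
    have := h.isEmbeddedSubmanifold.isManifold
    refine ⟨chartAt F p, IsManifold.chart_mem_maximalAtlas p, mem_chart_source F p, ?_⟩
    intro q hq v
    obtain ⟨y, rfl⟩ : ∃ y, q = (chartAt F p).symm y :=
      ⟨_, ((chartAt F p).left_inv hq).symm⟩
    have he := chart_mem_atlas F p
    obtain ⟨u, rfl⟩ := coordVec_surjective h.isAmbientChart he y v
    rw [h.apply_coordVec hJ he, chartDeriv_coordVec h.isAmbientChart he,
      chartDeriv_coordVec h.isAmbientChart he]

variable [FiniteDimensional ℂ H]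

/-- The restriction of `σ` to the tangent spaces of the orbit. -/
theorem exists_sigma (h : IsHolomorphicAtlas F H r) (hr : 0 < r) (p : rankOneOrbit H r) :
    ∃ g : RTangent F p →L[ℝ] RTangent F p →L[ℝ] ℝ,
      ∀ v w, g v w = sigma (p : Herm H) (inclDeriv F p v) (inclDeriv F p w) := by
  let ι : F →L[ℝ] Herm H := inclDeriv F p
  let g : F →L[ℝ] F →L[ℝ] ℝ := ‖(p : Herm H)‖⁻¹ • (trCLM H).bilinearComp ι ι
  refine ⟨g, fun v w => ?_⟩
  rw [(isScaledProjection_of_mem_rankOneOrbit hr p.2).sigma_eq (h.inclDeriv_mem p v)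
    (h.inclDeriv_mem p w)]
  rfl

theorem isRiemannianMetric (h : IsHolomorphicAtlas F H r) (hr : 0 < r)
    (hg : ∀ p v w, g p v w = sigma (p : Herm H) (inclDeriv F p v) (inclDeriv F p w)) :
    IsRiemannianMetric g where
  smooth e he u v := by
    have h1 : ContDiff ℝ ∞ fun y => (r ^ 2)⁻¹ *
        trCLM H (fderiv ℝ (param e) y u) (fderiv ℝ (param e) y v) :=
      contDiff_const.mul (contDiff_bilinear_apply _ (h.contDiff_fderiv_param_apply he u)
        (h.contDiff_fderiv_param_apply he v))
    refine h1.contDiffOn.congr fun y _ => ?_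
    rw [formInChart, hg, (isScaledProjection_of_mem_rankOneOrbit hr (e.symm y).2).sigma_eq
      (h.inclDeriv_mem _ _) (h.inclDeriv_mem _ _), inclDeriv_coordVec h.isAmbientChart he,
      inclDeriv_coordVec h.isAmbientChart he, norm_of_mem_rankOneOrbit (e.symm y).2]
    rfl
  symm p v w := by
    have hp := isScaledProjection_of_mem_rankOneOrbit hr p.2
    rw [hg, hg, hp.sigma_eq (h.inclDeriv_mem p v) (h.inclDeriv_mem p w),
      hp.sigma_eq (h.inclDeriv_mem p w) (h.inclDeriv_mem p v), trInner_comm]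
  pos p v hv := by
    have hp := isScaledProjection_of_mem_rankOneOrbit hr p.2
    rw [hg, hp.sigma_eq (h.inclDeriv_mem p v) (h.inclDeriv_mem p v)]
    have hne : inclDeriv F p v ≠ 0 := fun h0 =>
      hv (h.isEmbeddedSubmanifold.injective_inclDeriv p (h0.trans (map_zero _).symm))
    exact mul_pos (inv_pos.2 ((norm_nonneg _).lt_of_ne' hp.ne_zero)) (trInner_self_pos hne)

theorem formInChart_eq (h : IsHolomorphicAtlas F H r) (hr : 0 < r)
    (hη : ∀ p v w, η p v w = kksForm (p : Herm H) (inclDeriv F p v) (inclDeriv F p w))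
    (he : e ∈ atlas F (rankOneOrbit H r)) (u v : F) :
    formInChart η e u v = fun y => ((-((r ^ 2) ^ 2)⁻¹) • trCLM H) (param e y)
      (lieCLM H (fderiv ℝ (param e) y u) (fderiv ℝ (param e) y v)) := by
  funext y
  rw [formInChart, hη, (isScaledProjection_of_mem_rankOneOrbit hr (e.symm y).2).kksForm_eq
    (h.inclDeriv_mem _ _) (h.inclDeriv_mem _ _), inclDeriv_coordVec h.isAmbientChart he,
    inclDeriv_coordVec h.isAmbientChart he, norm_of_mem_rankOneOrbit (e.symm y).2]
  rfl

theorem isSymplecticForm (h : IsHolomorphicAtlas F H r) (hr : 0 < r)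
    (hη : ∀ p v w, η p v w = kksForm (p : Herm H) (inclDeriv F p v) (inclDeriv F p w)) :
    IsSymplecticForm η where
  smooth e he u v := by
    rw [h.formInChart_eq hr hη he]
    refine ContDiff.contDiffOn ?_
    exact contDiff_bilinear_apply _ (h.contDiff_param he)
      (contDiff_bilinear_apply _ (h.contDiff_fderiv_param_apply he u)
        (h.contDiff_fderiv_param_apply he v))
  alternating p v := by
    rw [hη, (isScaledProjection_of_mem_rankOneOrbit hr p.2).kksForm_eq (h.inclDeriv_mem p v)
      (h.inclDeriv_mem p v), lie_self]
    exact mul_eq_zero_of_right _ ((trBilin H p).map_zero)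
  nondegenerate p v hv := by
    have hp := isScaledProjection_of_mem_rankOneOrbit hr p.2
    obtain ⟨J, hJ⟩ := h.exists_restrict_calJ p
    by_contra hne
    have hne' : inclDeriv F p v ≠ 0 := fun h0 =>
      hne (h.isEmbeddedSubmanifold.injective_inclDeriv p (h0.trans (map_zero _).symm))
    -- `η(v, 𝒥 v)` is a positive multiple of the squared length of `v`
    have h1 := hv (J v)
    rw [hη, hJ, kksForm_calJ (h.inclDeriv_mem p v)] at h1
    exact (mul_pos (inv_pos.2 ((norm_nonneg _).lt_of_ne' hp.ne_zero))
      (trInner_self_pos hne')).ne' h1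
  closed e he y _ u v w := by
    rw [h.formInChart_eq hr hη he, h.formInChart_eq hr hη he, h.formInChart_eq hr hη he]
    refine exteriorDeriv_pullback ((h.contDiff_param he).of_le (by norm_cast))
      (fun a b => lie_antisymm a b) y (fun a b c => ?_) u v w
    have hp := isScaledProjection_of_mem_rankOneOrbit hr (e.symm y).2
    have h0 := hp.trInner_lie_eq_zero (h.fderiv_param_mem he y a) (h.fderiv_param_mem he y b)
      (h.fderiv_param_mem he y c)
    change _ * trInner _ (lie _ _) = 0
    rw [h0, mul_zero]

theorem isKahlerManifold (h : IsHolomorphicAtlas F H r) (hr : 0 < r)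
    (hJ : ∀ p v, inclDeriv F p (J p v) = calJ (p : Herm H) (inclDeriv F p v))
    (hg : ∀ p v w, g p v w = sigma (p : Herm H) (inclDeriv F p v) (inclDeriv F p w))
    (hη : ∀ p v w, η p v w = kksForm (p : Herm H) (inclDeriv F p v) (inclDeriv F p w)) :
    IsKahlerManifold F (rankOneOrbit H r) J g η where
  t2 := inferInstance
  secondCountable := by
    have : SecondCountableTopology (Herm H) :=
      have := FiniteDimensional.proper_real (Herm H)
      secondCountable_of_proper
    infer_instance
  isManifold := h.isEmbeddedSubmanifold.isManifold
  complexStructure := h.isComplexStructure hr hJ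
  metric := h.isRiemannianMetric hr hg
  symplectic := h.isSymplecticForm hr hη
  compatible p v w := by
    have hp := isScaledProjection_of_mem_rankOneOrbit hr p.2
    rw [hη, hg, hJ, kksForm_calJ (h.inclDeriv_mem p v),
      hp.sigma_eq (h.inclDeriv_mem p v) (h.inclDeriv_mem p w)]
  invariant p v w := by
    have hp := isScaledProjection_of_mem_rankOneOrbit hr p.2
    rw [hη, hη, hJ, hJ, hp.kksForm_calJ_calJ (h.inclDeriv_mem p v) (h.inclDeriv_mem p w)]

end Tensors

end IsHolomorphicAtlas

end KahlerOfCharts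

end QGeom

theorem mainTheorem7 (H : Type*) [NormedAddCommGroup H] [InnerProductSpace ℂ H]
    [CompleteSpace H] [FiniteDimensional ℂ H] :
    -- the tensor `𝒥` on the cone of rank-one positive operators
    (∀ ξ ∈ QGeom.rankOneCone H, ∀ A : QGeom.Herm H,
      QGeom.calJ ξ (QGeom.calJ ξ (QGeom.calJ ξ A)) = - QGeom.calJ ξ A) ∧
    -- `𝒥` preserves the tangent spaces of the cone, which are the ranges of the
    -- derivatives of the momentum map, and it depends smoothly on the point of the cone
    (∀ x : H, x ≠ 0 → ∀ y : H, ∃ y' : H,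
      QGeom.calJ (QGeom.momentum x) (fderiv ℝ QGeom.momentum x y) =
        fderiv ℝ QGeom.momentum x y') ∧
    (∀ A : QGeom.Herm H,
      ContDiffOn ℝ ∞ (fun x : H => QGeom.calJ (QGeom.momentum x) A) {x : H | x ≠ 0}) ∧
    ∀ r : ℝ, 0 < r →
      -- `D¹_r(H)` is a unitary orbit, of operators of norm `r²`
      (∀ ξ ∈ QGeom.rankOneOrbit H r, ‖ξ‖ = r ^ 2 ∧
        QGeom.rankOneOrbit H r = QGeom.unitaryOrbit ξ) ∧
      -- the tangent vectors lie in the domain of the partial tensor `σ`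
      (∀ ξ ∈ QGeom.rankOneOrbit H r, ∀ A : QGeom.Herm H,
        ∃ B, QGeom.IsSharp (QGeom.riemannJordan ξ) B (QGeom.lie A ξ)) ∧
      (∀ ξ ∈ QGeom.rankOneOrbit H r, ∀ A B : QGeom.Herm H,
        QGeom.sigma ξ (QGeom.lie A ξ) (QGeom.lie B ξ) =
          (1 / ‖ξ‖) * QGeom.trInner (QGeom.lie A ξ) (QGeom.lie B ξ)) ∧
      -- `𝒥` restricts to the tangent spaces of the orbit, with square `-1`
      (∀ ξ ∈ QGeom.rankOneOrbit H r, ∀ v ∈ QGeom.orbitTangent ξ,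
        QGeom.calJ ξ v ∈ QGeom.orbitTangent ξ ∧ QGeom.calJ ξ (QGeom.calJ ξ v) = -v) ∧
      (∀ ξ ∈ QGeom.rankOneOrbit H r, ∀ A B : QGeom.Herm H,
        QGeom.kksForm ξ (QGeom.lie A ξ) (QGeom.calJ ξ (QGeom.lie B ξ)) =
          QGeom.sigma ξ (QGeom.lie A ξ) (QGeom.lie B ξ)) ∧
      (∀ ξ ∈ QGeom.rankOneOrbit H r, ∀ A B : QGeom.Herm H,
        QGeom.kksForm ξ (QGeom.calJ ξ (QGeom.lie A ξ)) (QGeom.calJ ξ (QGeom.lie B ξ)) =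
          QGeom.kksForm ξ (QGeom.lie A ξ) (QGeom.lie B ξ)) ∧
      -- `D¹_r(H)` is an embedded submanifold of the space of Hermitian operators, of complex
      -- dimension `n - 1`, and `(D¹_r(H), 𝒥, σ, η)` is a Kähler manifold
      ∃ _ : ChartedSpace (EuclideanSpace ℂ (Fin (Module.finrank ℂ H - 1)))
          (QGeom.rankOneOrbit H r),
        QGeom.IsEmbeddedSubmanifold (EuclideanSpace ℂ (Fin (Module.finrank ℂ H - 1)))
          (QGeom.rankOneOrbit H r) QGeom.orbitTangent ∧
        ∃ (J : ∀ p : QGeom.rankOneOrbit H r,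
              QGeom.RTangent (EuclideanSpace ℂ (Fin (Module.finrank ℂ H - 1))) p →L[ℝ]
              QGeom.RTangent (EuclideanSpace ℂ (Fin (Module.finrank ℂ H - 1))) p)
          (g η : ∀ p : QGeom.rankOneOrbit H r,
              QGeom.RTangent (EuclideanSpace ℂ (Fin (Module.finrank ℂ H - 1))) p →L[ℝ]
              QGeom.RTangent (EuclideanSpace ℂ (Fin (Module.finrank ℂ H - 1))) p →L[ℝ] ℝ),
          (∀ p v, QGeom.inclDeriv _ p (J p v) =
            QGeom.calJ (p : QGeom.Herm H) (QGeom.inclDeriv _ p v)) ∧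
          (∀ p v w, g p v w =
            QGeom.sigma (p : QGeom.Herm H) (QGeom.inclDeriv _ p v) (QGeom.inclDeriv _ p w)) ∧
          (∀ p v w, η p v w =
            QGeom.kksForm (p : QGeom.Herm H) (QGeom.inclDeriv _ p v)
              (QGeom.inclDeriv _ p w)) ∧
          QGeom.IsKahlerManifold (EuclideanSpace ℂ (Fin (Module.finrank ℂ H - 1)))
            (QGeom.rankOneOrbit H r) J g η := by

  refine ⟨fun ξ hξ A => ?_, fun x hx y => QGeom.exists_calJ_fderiv_momentum hx y,
    QGeom.contDiffOn_calJ_momentum, fun r hr => ?_⟩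
  · rw [(QGeom.isScaledProjection_of_mem_rankOneCone hξ).calJ_calJ
      (QGeom.calJ_mem_orbitTangent ξ A)]
  have hproj : ∀ ξ ∈ QGeom.rankOneOrbit H r, QGeom.IsScaledProjection ξ :=
    fun _ => QGeom.isScaledProjection_of_mem_rankOneOrbit hr
  have hmem : ∀ ξ A : QGeom.Herm H, QGeom.lie A ξ ∈ QGeom.orbitTangent ξ :=
    QGeom.lie_mem_orbitTangent
  refine ⟨fun ξ hξ => ⟨QGeom.norm_of_mem_rankOneOrbit hξ,
      QGeom.rankOneOrbit_eq_unitaryOrbit hr hξ⟩,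
    fun ξ hξ A => ⟨_, (hproj ξ hξ).isSharp_riemannJordan (hmem ξ A)⟩, fun ξ hξ A B => ?_,
    fun ξ hξ v hv => ⟨QGeom.calJ_mem_orbitTangent ξ v, (hproj ξ hξ).calJ_calJ hv⟩,
    fun ξ hξ A B => ?_,
    fun ξ hξ A B => (hproj ξ hξ).kksForm_calJ_calJ (hmem ξ A) (hmem ξ B), ?_⟩
  · rw [(hproj ξ hξ).sigma_eq (hmem ξ A) (hmem ξ B), one_div]
  · rw [QGeom.kksForm_calJ (hmem ξ A), (hproj ξ hξ).sigma_eq (hmem ξ A) (hmem ξ B)]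
  let _ := QGeom.rankOneOrbitChartedSpace (H := H) hr
  have h : QGeom.IsHolomorphicAtlas (EuclideanSpace ℂ (Fin (Module.finrank ℂ H - 1))) H r :=
    QGeom.isHolomorphicAtlas_affineCharts hr
  choose J hJ using h.exists_restrict_calJ
  choose g hg using h.exists_sigma hr
  choose η hη using h.exists_kksForm hr
  exact ⟨QGeom.rankOneOrbitChartedSpace hr, h.isEmbeddedSubmanifold, J, g, η, hJ, hg, hη,
    h.isKahlerManifold hr hJ hg hη⟩
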